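/- Write $e(t) = e^{2\pi i t}$, and for $f:\mathbb{Z}\to\mathbb{C}$ let $\|f\|_{\ell^p} = \left(\sum_{x\in\mathbb{Z}} |f(x)|^p\right)^{1/p}$. Let $d\geq 2$ be an integer and let $1<p<\infty$. There is a constant $C=C_{d,p}>0$, depending only on $d$ and $p$, such that for every $\epsilon>0$ there exists a measurable set $E_\epsilon=E_{\epsilon,d,p}\subset[0,1]$ of Lebesgue measure $|E_\epsilon|<\epsilon$ with the following property. For every $f\in\ell^p(\mathbb{Z})$, the series $\sum_{m\in\mathbb{Z},\,m\neq 0} f(x-m)\frac{e(\lambda m^d)}{m}$ converges absolutely for all $x\in\mathbb{Z}$ and $\lambda\in\mathbb{R}$, and \[ \left\| \sup_{\lambda\in[0,1]\setminus E_\epsilon} \left| \sum_{m\neq 0} f(x-m)\frac{e(\lambda m^d)}{m} \right| \right\|_{\ell^p(x\in\mathbb{Z})} \leq C_{d,p}\,\max\left\{1,\log\tfrac1\epsilon\right\}\,\|f\|_{\ell^p}. \] In particular, for $0<\epsilon\leq 1/2$ the $\ell^p$ operator norm is at most a constant depending only on $d,p$ times $\log\frac1\epsilon$. -/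

import Mathlib

open MeasureTheory
open scoped ENNReal

noncomputable section

/-- The `m`-th summand `f(x - m) e(t m^d) / m`, `e(s) = exp(2πis)`, of the modulated discrete
Hilbert transform with modulation parameter `t`, for a nonzero integer `m`. -/
def modulatedTerm (d : ℕ) (f : ℤ → ℂ) (t : ℝ) (x : ℤ) (m : {m : ℤ // m ≠ 0}) : ℂ :=
  f (x - m.1) * Complex.exp (2 * Real.pi * Complex.I * (t : ℂ) * (m.1 : ℂ) ^ d) / (m.1 : ℂ)

/-- The modulated discrete Hilbert transform `∑_{m ≠ 0} f(x - m) e(t m^d) / m`. -/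
def modulatedHilbert (d : ℕ) (f : ℤ → ℂ) (t : ℝ) (x : ℤ) : ℂ :=
  ∑' m : {m : ℤ // m ≠ 0}, modulatedTerm d f t x m

/-- The maximally modulated operator `x ↦ sup_{t ∈ [0,1] \ E} |∑_{m ≠ 0} f(x - m) e(t m^d) / m|`,
with values in `[0, ∞]`. As `m^d` is an integer, the summands are 1-periodic in `t`, so `[0, 1]`
represents all real modulation parameters. -/
def restrictedCarleson (d : ℕ) (E : Set ℝ) (f : ℤ → ℂ) (x : ℤ) : ℝ≥0∞ :=
  ⨆ t ∈ Set.Icc (0 : ℝ) 1 \ E, ‖modulatedHilbert d f t x‖ₑ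

end

/-! The series is cut into dyadic shells `2 ^ j ≤ |m| < 2 ^ (j + 1)`. Each shell has operator norm
at most 6 for every choice of `t x`, by Hölder. The gain is that, off a set of parameters of measure
`O(2 ^ (-j/4))`, the norm is `O(2 ^ (-η j))`. The exceptional set is the union of those bad sets
over `j ≥ J`, with `J` of size `max 1 (log (1/ε))`: its measure is a geometric tail, the first `J`
shells cost `6 J`, and the remaining ones sum to a constant (`mainTheorem9`).

The decay comes from `TT*` applied with a parameter `t x` chosen at each point. The kernel at
displacement `h ≠ 0` is an exponential sum with phase `ν m^d - l (m - h)^d = (ν - l) m^d + l (m^d -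
(m - h)^d)`. It must be small for most `l` and for all `ν` at once.
`exists_majorant_exponential_sum` bounds a high moment of such sums by a function of `l` alone with
small mean, and Markov's inequality then gives `exists_exceptional_set`. The moment bound is an
induction on the degree: van der Corput differencing lowers the degrees of both parts of the phase.
At degree two the supremum over `μ` is paid for by the `O(N^2)` values of a sum of three quadratic
values, while orthogonality in `l` leaves a count of `O(N^(7/2))` solutions of a quadratic system,
so the sixth moment is `O(N^(6 - 1/2))` against the trivial `N^6`.

The `ℓ²` gain for bounded functions becomes an `ℓ^p` gain by truncation, on intervals of length `N`
(`sum_rpow_shellSum_le`), and averaging over intervals makes it global. The supremum is replaced by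
a near-maximising `t x` (`exists_linearization`). -/

/-! ### Orthogonality and mean squares uniform in one frequency. -/

/-- The additive character `e(x) = exp(2πix)`. -/
noncomputable def addExp (x : ℝ) : ℂ := Complex.exp (2 * Real.pi * Complex.I * (x : ℂ))

theorem addExp_add (x y : ℝ) : addExp (x + y) = addExp x * addExp y := by
  rw [addExp, addExp, addExp, ← Complex.exp_add]
  congr 1
  push_cast
  ring

theorem conj_addExp (x : ℝ) : starRingEnd ℂ (addExp x) = addExp (-x) := by
  rw [addExp, addExp, ← Complex.exp_conj]
  congr 1
  simp [map_ofNat]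

theorem norm_addExp (x : ℝ) : ‖addExp x‖ = 1 := by
  have h : 2 * Real.pi * Complex.I * (x : ℂ) = ((2 * Real.pi * x : ℝ) : ℂ) * Complex.I := by
    push_cast
    ring
  rw [addExp, h, Complex.norm_exp_ofReal_mul_I]

@[fun_prop]
theorem continuous_addExp : Continuous addExp := by
  unfold addExp
  fun_prop

theorem integral_addExp_int (n : ℤ) :
    ∫ l in (0 : ℝ)..1, addExp (l * n) = if n = 0 then 1 else 0 := by
  split_ifs with h
  · simp [h, addExp]
  · have hc : (2 * Real.pi * Complex.I * n : ℂ) ≠ 0 := by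
      simp [h, Real.pi_ne_zero]
    have : ∀ l : ℝ, addExp (l * n) = Complex.exp ((2 * Real.pi * Complex.I * n : ℂ) * l) := by
      intro l
      rw [addExp]
      congr 1
      push_cast
      ring
    simp_rw [this]
    rw [integral_exp_mul_complex hc]
    have h1 : Complex.exp (2 * Real.pi * Complex.I * n * ((1 : ℝ) : ℂ)) = 1 := by
      rw [Complex.exp_eq_one_iff]
      exact ⟨n, by push_cast; ring⟩
    rw [h1]
    simp

theorem norm_sq_eq_sum_pairs {α : Type*} (T : Finset α) (z : α → ℂ) :
    ((‖∑ τ ∈ T, z τ‖ ^ 2 : ℝ) : ℂ) = ∑ x ∈ T ×ˢ T, z x.1 * starRingEnd ℂ (z x.2) := by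
  rw [Finset.sum_product, Complex.ofReal_pow, ← Complex.mul_conj', map_sum, Finset.sum_mul_sum]

/-- The mean square of a trigonometric polynomial with coefficients bounded by one is at most the
number of pairs of equal frequencies. -/
theorem integral_norm_sq_sum_addExp_le {α : Type*} (T : Finset α) (a : α → ℂ)
    (ha : ∀ τ ∈ T, ‖a τ‖ ≤ 1) (R : α → ℤ) :
    ∫ l in (0 : ℝ)..1, ‖∑ τ ∈ T, a τ * addExp (l * R τ)‖ ^ 2 ≤
      (((T ×ˢ T).filter fun x => R x.1 = R x.2).card : ℝ) := by
  have key : ((∫ l in (0 : ℝ)..1, ‖∑ τ ∈ T, a τ * addExp (l * R τ)‖ ^ 2 : ℝ) : ℂ) =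
      ∑ x ∈ (T ×ˢ T).filter (fun x => R x.1 = R x.2), a x.1 * starRingEnd ℂ (a x.2) := by
    rw [← intervalIntegral.integral_ofReal]
    simp_rw [norm_sq_eq_sum_pairs]
    rw [intervalIntegral.integral_finsetSum]
    · rw [Finset.sum_filter]
      refine Finset.sum_congr rfl fun x _ => ?_
      have : ∀ l : ℝ, a x.1 * addExp (l * R x.1) * starRingEnd ℂ (a x.2 * addExp (l * R x.2)) =
          a x.1 * starRingEnd ℂ (a x.2) * addExp (l * ((R x.1 - R x.2 : ℤ) : ℝ)) := by
        intro l
        have h2 : l * ((R x.1 - R x.2 : ℤ) : ℝ) = l * R x.1 + -(l * R x.2) := by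
          push_cast
          ring
        rw [h2, addExp_add, map_mul, conj_addExp]
        ring
      simp_rw [this]
      rw [intervalIntegral.integral_const_mul, integral_addExp_int]
      by_cases h : R x.1 = R x.2 <;> simp [h, sub_eq_zero]
    · intro x _
      apply Continuous.intervalIntegrable
      have h3 : Continuous fun z : ℂ => starRingEnd ℂ z := Complex.continuous_conj
      fun_prop
  have h0 : 0 ≤ ∫ l in (0 : ℝ)..1, ‖∑ τ ∈ T, a τ * addExp (l * R τ)‖ ^ 2 :=
    intervalIntegral.integral_nonneg zero_le_one fun _ _ => by positivity
  rw [← abs_of_nonneg h0, ← Real.norm_eq_abs, ← Complex.norm_real, key]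
  refine (norm_sum_le _ _).trans ?_
  rw [Finset.card_eq_sum_ones, Nat.cast_sum]
  refine Finset.sum_le_sum fun x hx => ?_
  simp only [Finset.mem_filter, Finset.mem_product] at hx
  rw [norm_mul, RCLike.norm_conj, Nat.cast_one]
  exact mul_le_one₀ (ha _ hx.1.1) (norm_nonneg _) (ha _ hx.1.2)

/-- A bound for `|∑ a e(μ P + l R)|²`, uniform in `μ`, whose mean over `l` is controlled by the
number of coincidences of the pair `(P, R)`. -/
theorem exists_majorant_sq {α : Type*} (T : Finset α) (a : α → ℂ) (ha : ∀ τ ∈ T, ‖a τ‖ ≤ 1)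
    (P R : α → ℤ) (V : Finset ℤ) (hV : ∀ τ ∈ T, P τ ∈ V) :
    ∃ F : ℝ → ℝ, Continuous F ∧
      (∀ μ l : ℝ, ‖∑ τ ∈ T, a τ * addExp (μ * P τ + l * R τ)‖ ^ 2 ≤ F l) ∧
      ∫ l in (0 : ℝ)..1, F l ≤
        V.card * (((T ×ˢ T).filter fun x => P x.1 = P x.2 ∧ R x.1 = R x.2).card : ℝ) := by
  -- Grouping terms by the value `k` of `P` leaves `μ` only in the unimodular factor `addExp (μ *
  -- k)`, which the triangle inequality removes; Cauchy–Schwarz over `k` costs `V.card`.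
  refine ⟨fun l => V.card * ∑ k ∈ V, ‖∑ τ ∈ T with P τ = k, a τ * addExp (l * R τ)‖ ^ 2,
    by fun_prop, fun μ l => ?_, ?_⟩
  · have h1 : ∑ τ ∈ T, a τ * addExp (μ * P τ + l * R τ) =
        ∑ k ∈ V, addExp (μ * k) * ∑ τ ∈ T with P τ = k, a τ * addExp (l * R τ) := by
      rw [← Finset.sum_fiberwise_of_maps_to hV]
      refine Finset.sum_congr rfl fun k _ => ?_
      rw [Finset.mul_sum]
      refine Finset.sum_congr rfl fun τ hτ => ?_
      rw [← (Finset.mem_filter.1 hτ).2, addExp_add]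
      ring
    have h2 : ‖∑ τ ∈ T, a τ * addExp (μ * P τ + l * R τ)‖ ≤
        ∑ k ∈ V, ‖∑ τ ∈ T with P τ = k, a τ * addExp (l * R τ)‖ := by
      rw [h1]
      refine norm_sum_le_of_le _ fun k _ => ?_
      rw [norm_mul, norm_addExp, one_mul]
    exact (pow_le_pow_left₀ (norm_nonneg _) h2 2).trans sq_sum_le_card_mul_sum_sq
  · rw [intervalIntegral.integral_const_mul, intervalIntegral.integral_finsetSum]
    · refine mul_le_mul_of_nonneg_left ?_ (Nat.cast_nonneg _)
      refine (Finset.sum_le_sum fun k _ => integral_norm_sq_sum_addExp_le _ a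
        (fun τ hτ => ha τ (Finset.mem_filter.1 hτ).1) R).trans ?_
      rw [← Nat.cast_sum]
      have h4 : ∀ x ∈ (T ×ˢ T).filter (fun x => P x.1 = P x.2 ∧ R x.1 = R x.2), P x.1 ∈ V := by
        intro x hx
        simp only [Finset.mem_filter, Finset.mem_product] at hx
        exact hV _ hx.1.1
      rw [Finset.card_eq_sum_card_fiberwise h4]
      refine le_of_eq ?_
      congr 1
      refine Finset.sum_congr rfl fun k _ => ?_
      congr 1
      ext x
      simp only [Finset.mem_filter, Finset.mem_product]
      constructor
      · rintro ⟨⟨⟨h1, h2⟩, h3, h4⟩, h5⟩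
        exact ⟨⟨⟨h1, h3⟩, h2.trans h4.symm, h5⟩, h2⟩
      · rintro ⟨⟨⟨h1, h2⟩, h3, h4⟩, h5⟩
        exact ⟨⟨⟨h1, h5⟩, h2, h3 ▸ h5⟩, h4⟩
    · intro k _
      apply Continuous.intervalIntegrable
      fun_prop

/-! ### Counting solutions of `ab = ce` and of the quadratic system. -/

theorem sum_natAbs_le (M : ℕ) (g : ℕ → ℝ) (hg : ∀ n, 0 ≤ g n) :
    ∑ x ∈ (Finset.Icc (-(M : ℤ)) M).erase 0, g x.natAbs ≤ 2 * ∑ n ∈ Finset.Icc 1 M, g n := by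
  have hmap : ∀ x ∈ (Finset.Icc (-(M : ℤ)) M).erase 0, x.natAbs ∈ Finset.Icc 1 M := by
    intro x hx
    simp only [Finset.mem_erase, Finset.mem_Icc] at hx ⊢
    omega
  rw [← Finset.sum_fiberwise_of_maps_to hmap, Finset.mul_sum]
  refine Finset.sum_le_sum fun n _ => ?_
  rw [Finset.sum_congr rfl (g := fun _ => g n) fun x hx => by rw [(Finset.mem_filter.1 hx).2],
    Finset.sum_const, nsmul_eq_mul]
  refine mul_le_mul_of_nonneg_right ?_ (hg n)
  have : ((Finset.Icc (-(M : ℤ)) M).erase 0).filter (fun x => x.natAbs = n) ⊆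
      {(n : ℤ), -(n : ℤ)} := by
    intro x hx
    simp only [Finset.mem_filter, Finset.mem_insert, Finset.mem_singleton] at hx ⊢
    omega
  exact_mod_cast (Finset.card_le_card this).trans Finset.card_le_two

theorem one_add_log_le {x : ℝ} (hx : 1 ≤ x) : 1 + Real.log x ≤ 5 * x ^ (1 / 4 : ℝ) := by
  have h1 := Real.log_le_rpow_div (zero_le_one.trans hx) (ε := 1 / 4) (by norm_num)
  have h2 := Real.one_le_rpow hx (z := 1 / 4) (by norm_num)
  have h3 : x ^ (1 / 4 : ℝ) / (1 / 4) = 4 * x ^ (1 / 4 : ℝ) := by ring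
  linarith

/-- Integer points in the box of side `M` under the hyperbola `|xy| ≤ M`, off the axes. -/
noncomputable def hyperbolaPoints (M : ℕ) : Finset (ℤ × ℤ) :=
  (Finset.Icc (-(M : ℤ)) M ×ˢ Finset.Icc (-(M : ℤ)) M).filter
    fun x => x.1 * x.2 ≠ 0 ∧ |x.1 * x.2| ≤ M

/-- The fibre over `x` has at most `2 ⌊M/|x|⌋ + 1 ≤ 3 M/|x|` points; the harmonic sum gives a
logarithm, absorbed into `M ^ (1/4)`. -/
theorem card_hyperbolaPoints_le {M : ℕ} (hM : 1 ≤ M) :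
    ((hyperbolaPoints M).card : ℝ) ≤ 30 * (M : ℝ) ^ (5 / 4 : ℝ) := by
  have hM' : (1 : ℝ) ≤ M := by exact_mod_cast hM
  have hmap : ∀ x ∈ hyperbolaPoints M, x.1 ∈ (Finset.Icc (-(M : ℤ)) M).erase 0 := by
    intro x hx
    simp only [hyperbolaPoints, Finset.mem_filter, Finset.mem_product] at hx
    exact Finset.mem_erase.2 ⟨left_ne_zero_of_mul hx.2.1, hx.1.1⟩
  have h1 : ((hyperbolaPoints M).card : ℝ) ≤
      ∑ x ∈ (Finset.Icc (-(M : ℤ)) M).erase 0, 3 * ((M : ℝ) * ((x.natAbs : ℝ))⁻¹) := by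
    rw [Finset.card_eq_sum_card_fiberwise hmap, Nat.cast_sum]
    refine Finset.sum_le_sum fun x hx => ?_
    simp only [Finset.mem_erase, Finset.mem_Icc] at hx
    have hx1 : 1 ≤ x.natAbs := by omega
    have hx2 : x.natAbs ≤ M := by omega
    have hsub : ((hyperbolaPoints M).filter fun y => y.1 = x) ⊆
        ({x} : Finset ℤ) ×ˢ Finset.Icc (-((M / x.natAbs : ℕ) : ℤ)) ((M / x.natAbs : ℕ) : ℤ) := by
      intro y hy
      simp only [hyperbolaPoints, Finset.mem_filter, Finset.mem_product] at hy
      obtain ⟨⟨-, -, hy2⟩, rfl⟩ := hy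
      have h3 : y.2.natAbs * y.1.natAbs ≤ M := by
        rw [← Int.natAbs_mul, mul_comm]
        rw [Int.abs_eq_natAbs] at hy2
        exact_mod_cast hy2
      have h4 := (Nat.le_div_iff_mul_le (by omega)).2 h3
      simp only [Finset.mem_product, Finset.mem_singleton, Finset.mem_Icc, true_and]
      omega
    have hc := Finset.card_le_card hsub
    rw [Finset.card_product, Finset.card_singleton, one_mul, Int.card_Icc] at hc
    have h5 : 1 ≤ M / x.natAbs := Nat.div_pos hx2 hx1
    have h6 : ((hyperbolaPoints M).filter fun y => y.1 = x).card ≤ 3 * (M / x.natAbs) := by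
      omega
    have h7 : ((M / x.natAbs : ℕ) : ℝ) ≤ M / x.natAbs := Nat.cast_div_le
    calc (((hyperbolaPoints M).filter fun y => y.1 = x).card : ℝ)
        ≤ ((3 * (M / x.natAbs) : ℕ) : ℝ) := by exact_mod_cast h6
      _ ≤ 3 * ((M : ℝ) / x.natAbs) := by
        rw [Nat.cast_mul]
        exact mul_le_mul_of_nonneg_left h7 (by norm_num)
      _ = _ := by rw [div_eq_mul_inv]
  have h2 := sum_natAbs_le M (fun n => 3 * ((M : ℝ) * (n : ℝ)⁻¹)) fun n => by positivity
  have h3 := harmonic_le_one_add_log M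
  rw [harmonic_eq_sum_Icc] at h3
  push_cast at h3
  have h4 := one_add_log_le hM'
  have h5 : (M : ℝ) ^ (5 / 4 : ℝ) = M * (M : ℝ) ^ (1 / 4 : ℝ) := by
    rw [← Real.rpow_one_add' (by positivity) (by norm_num)]
    norm_num
  rw [h5]
  calc _ ≤ _ := h1.trans h2
    _ ≤ 2 * (3 * (M * (5 * (M : ℝ) ^ (1 / 4 : ℝ)))) := by
      rw [← Finset.mul_sum, ← Finset.mul_sum]
      gcongr
      exact h3.trans h4
    _ = _ := by ring

/-- The quadruples of integers in `[-M, M]` with `ab = ce`. -/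
noncomputable def equalProducts (M : ℕ) : Finset ((ℤ × ℤ) × (ℤ × ℤ)) :=
  ((Finset.Icc (-(M : ℤ)) M ×ˢ Finset.Icc (-(M : ℤ)) M) ×ˢ
    (Finset.Icc (-(M : ℤ)) M ×ˢ Finset.Icc (-(M : ℤ)) M)).filter
    fun x => x.1.1 * x.1.2 = x.2.1 * x.2.2

/-- Removing `g = gcd a c` leaves coprime `a'`, `c'` with `a' b = c' e`, so `a'` divides `e`. -/
theorem exists_factor_of_mul_eq_mul {a b c e : ℤ} (ha : a ≠ 0) (h : a * b = c * e) :
    ∃ g a' c' k : ℤ, a = g * a' ∧ b = c' * k ∧ c = g * c' ∧ e = a' * k := by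
  have hg : 0 < Int.gcd a c := Int.gcd_pos_of_ne_zero_left _ ha
  obtain ⟨a', c', hcop, h1, h2⟩ := Int.exists_gcd_one hg
  have hg' : (Int.gcd a c : ℤ) ≠ 0 := by exact_mod_cast hg.ne'
  generalize (Int.gcd a c : ℤ) = g at h1 h2 hg'
  subst h1 h2
  have ha' : a' ≠ 0 := left_ne_zero_of_mul ha
  have h3 : a' * b = c' * e := by
    refine mul_left_cancel₀ hg' ?_
    linear_combination h
  have h4 : IsCoprime a' c' := Int.isCoprime_iff_gcd_eq_one.2 hcop
  obtain ⟨k, rfl⟩ := h4.dvd_of_dvd_mul_left (Dvd.intro _ h3)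
  refine ⟨g, a', c', k, mul_comm _ _, mul_left_cancel₀ ha' ?_, mul_comm _ _, rfl⟩
  linear_combination h3

theorem abs_le_of_mul_abs_le {x y M : ℤ} (hx : x ≠ 0) (h : |x * y| ≤ M) : |y| ≤ M := by
  rw [abs_mul] at h
  have : 1 ≤ |x| := Int.one_le_abs hx
  nlinarith [abs_nonneg y]

theorem mem_hyperbolaPoints_of {M : ℕ} {x y : ℤ} (h0 : x * y ≠ 0) (h : |x * y| ≤ M) :
    (x, y) ∈ hyperbolaPoints M := by
  simp only [hyperbolaPoints, Finset.mem_filter, Finset.mem_product, Finset.mem_Icc, ← abs_le]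
  refine ⟨⟨abs_le_of_mul_abs_le (right_ne_zero_of_mul h0) (by rwa [mul_comm]),
    abs_le_of_mul_abs_le (left_ne_zero_of_mul h0) h⟩, h0, h⟩

/-- When the common product is nonzero, the factorisation turns a solution into two points `(g,
a')`, `(c', k)` under the hyperbola. When it is zero, each pair lies on the axes. Hence `936 = 6² +
30²`. -/
theorem card_equalProducts_le {M : ℕ} (hM : 1 ≤ M) :
    ((equalProducts M).card : ℝ) ≤ 936 * (M : ℝ) ^ (5 / 2 : ℝ) := by
  have hM' : (1 : ℝ) ≤ M := by exact_mod_cast hM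
  set I := Finset.Icc (-(M : ℤ)) M with hI
  set Z : Finset (ℤ × ℤ) := ({0} ×ˢ I) ∪ (I ×ˢ {0}) with hZ
  set D := hyperbolaPoints M
  let φ : (ℤ × ℤ) × (ℤ × ℤ) → (ℤ × ℤ) × (ℤ × ℤ) :=
    fun x => ((x.1.1 * x.1.2, x.2.1 * x.2.2), (x.1.1 * x.2.1, x.1.2 * x.2.2))
  have hsub : equalProducts M ⊆ (Z ×ˢ Z) ∪ (D ×ˢ D).image φ := by
    rintro ⟨⟨a, b⟩, ⟨c, e⟩⟩ h
    simp only [equalProducts, Finset.mem_filter, Finset.mem_product] at h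
    obtain ⟨⟨⟨ha, hb⟩, hc, he⟩, h⟩ := h
    by_cases h0 : a * b = 0
    · refine Finset.mem_union_left _ ?_
      have h1 : c * e = 0 := h ▸ h0
      rw [mul_eq_zero] at h0 h1
      simp only [hZ, Finset.mem_product, Finset.mem_union, Finset.mem_singleton]
      tauto
    · refine Finset.mem_union_right _ ?_
      obtain ⟨g, a', c', k, rfl, rfl, rfl, rfl⟩ :=
        exists_factor_of_mul_eq_mul (left_ne_zero_of_mul h0) h
      refine Finset.mem_image.2 ⟨((g, a'), (c', k)), ?_, rfl⟩
      rw [Finset.mem_Icc, ← abs_le] at ha hb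
      exact Finset.mem_product.2 ⟨mem_hyperbolaPoints_of (left_ne_zero_of_mul h0) ha,
        mem_hyperbolaPoints_of (right_ne_zero_of_mul h0) hb⟩
  have hZc : Z.card ≤ 6 * M := by
    refine (Finset.card_union_le _ _).trans ?_
    simp only [Finset.card_product, Finset.card_singleton, hI, Int.card_Icc]
    omega
  have hc : (equalProducts M).card ≤ (6 * M) * (6 * M) + D.card * D.card := by
    refine (Finset.card_le_card hsub).trans ((Finset.card_union_le _ _).trans
      (add_le_add ?_ (Finset.card_image_le.trans (Finset.card_product _ _).le)))
    rw [Finset.card_product]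
    exact Nat.mul_le_mul hZc hZc
  have hDc := card_hyperbolaPoints_le hM
  have h1 : (M : ℝ) ^ (5 / 2 : ℝ) = (M : ℝ) ^ (5 / 4 : ℝ) * (M : ℝ) ^ (5 / 4 : ℝ) := by
    rw [← Real.rpow_add (by positivity)]
    norm_num
  have h2 : (M : ℝ) ≤ (M : ℝ) ^ (5 / 4 : ℝ) := Real.self_le_rpow_of_one_le hM' (by norm_num)
  calc ((equalProducts M).card : ℝ)
      ≤ (6 * M) * (6 * M) + D.card * D.card := by exact_mod_cast hc
    _ ≤ (6 * (M : ℝ) ^ (5 / 4 : ℝ)) * (6 * (M : ℝ) ^ (5 / 4 : ℝ)) +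
        (30 * (M : ℝ) ^ (5 / 4 : ℝ)) * (30 * (M : ℝ) ^ (5 / 4 : ℝ)) := by gcongr
    _ = _ := by rw [h1]; ring

/-- The cube `[-N, N]³` of integer triples. -/
noncomputable def tripleBox (N : ℕ) : Finset (ℤ × ℤ × ℤ) :=
  Finset.Icc (-(N : ℤ)) N ×ˢ Finset.Icc (-(N : ℤ)) N ×ˢ Finset.Icc (-(N : ℤ)) N

/-- The number of solutions of `∑ mᵢ = ∑ nᵢ`, `∑ mᵢ² = ∑ nᵢ²` with three variables on each side. -/
theorem card_quadratic_system_le {N : ℕ} (hN : 1 ≤ N) :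
    (((tripleBox N ×ˢ tripleBox N).filter fun x =>
      x.1.1 + x.1.2.1 + x.1.2.2 = x.2.1 + x.2.2.1 + x.2.2.2 ∧
      x.1.1 ^ 2 + x.1.2.1 ^ 2 + x.1.2.2 ^ 2 = x.2.1 ^ 2 + x.2.2.1 ^ 2 + x.2.2.2 ^ 2).card : ℝ) ≤
      22464 * (N : ℝ) ^ (7 / 2 : ℝ) := by
  set S := (tripleBox N ×ˢ tripleBox N).filter fun x =>
      x.1.1 + x.1.2.1 + x.1.2.2 = x.2.1 + x.2.2.1 + x.2.2.2 ∧
      x.1.1 ^ 2 + x.1.2.1 ^ 2 + x.1.2.2 ^ 2 = x.2.1 ^ 2 + x.2.2.1 ^ 2 + x.2.2.2 ^ 2 with hS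
  -- The two equations imply `(m₁ - n₃)(m₂ - n₃) = (n₁ - m₃)(n₂ - m₃)`. Together with `n₃` these
  -- four differences recover the solution, since the linear equation returns `m₃`.
  let ψ : (ℤ × ℤ × ℤ) × (ℤ × ℤ × ℤ) → ℤ × ((ℤ × ℤ) × (ℤ × ℤ)) := fun x =>
    (x.2.2.2, ((x.1.1 - x.2.2.2, x.1.2.1 - x.2.2.2), (x.2.1 - x.1.2.2, x.2.2.1 - x.1.2.2)))
  have hcard : S.card ≤ (Finset.Icc (-(N : ℤ)) N ×ˢ equalProducts (2 * N)).card := by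
    refine Finset.card_le_card_of_injOn ψ ?_ ?_
    · rintro ⟨⟨m1, m2, m3⟩, ⟨n1, n2, n3⟩⟩ hx
      simp only [hS, tripleBox, Finset.coe_filter, Finset.mem_product, Finset.mem_Icc,
        Set.mem_ofPred_eq] at hx
      obtain ⟨⟨⟨h1, h2, h3⟩, h4, h5, h6⟩, h7, h8⟩ := hx
      simp only [ψ, Finset.mem_coe, equalProducts, Finset.mem_filter, Finset.mem_product,
        Finset.mem_Icc]
      push_cast
      refine ⟨h6, ⟨⟨⟨?_, ?_⟩, ?_, ?_⟩, ?_⟩⟩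
      any_goals constructor <;> omega
      have h9 : n3 = m1 + m2 + m3 - n1 - n2 := by omega
      subst h9
      have : (2 : ℤ) ≠ 0 := by norm_num
      refine mul_left_cancel₀ this ?_
      linear_combination -h8
    · rintro ⟨⟨m1, m2, m3⟩, ⟨n1, n2, n3⟩⟩ hx ⟨⟨m1', m2', m3'⟩, ⟨n1', n2', n3'⟩⟩ hy h
      simp only [hS, Finset.coe_filter, Set.mem_ofPred_eq] at hx hy
      simp only [ψ, Prod.mk.injEq] at h ⊢
      omega
  rw [Finset.card_product, Int.card_Icc] at hcard
  have h0 : ((N : ℤ) + 1 - -(N : ℤ)).toNat ≤ 3 * N := by omega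
  have h1 := card_equalProducts_le (M := 2 * N) (by omega)
  have h2 : ((2 * N : ℕ) : ℝ) ^ (5 / 2 : ℝ) ≤ 8 * (N : ℝ) ^ (5 / 2 : ℝ) := by
    push_cast
    rw [Real.mul_rpow (by norm_num) (by positivity)]
    refine mul_le_mul_of_nonneg_right ?_ (by positivity)
    calc (2 : ℝ) ^ (5 / 2 : ℝ) ≤ 2 ^ (3 : ℝ) :=
          Real.rpow_le_rpow_of_exponent_le (by norm_num) (by norm_num)
      _ = 8 := by norm_num
  have h3 : (N : ℝ) ^ (7 / 2 : ℝ) = N * (N : ℝ) ^ (5 / 2 : ℝ) := by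
    rw [← Real.rpow_one_add' (by positivity) (by norm_num)]
    norm_num
  calc (S.card : ℝ) ≤ ((3 * N : ℕ) : ℝ) * ((equalProducts (2 * N)).card : ℝ) := by
        exact_mod_cast hcard.trans (Nat.mul_le_mul_right _ h0)
    _ ≤ ((3 * N : ℕ) : ℝ) * (936 * (8 * (N : ℝ) ^ (5 / 2 : ℝ))) := by
        refine mul_le_mul_of_nonneg_left (h1.trans ?_) (Nat.cast_nonneg _)
        exact mul_le_mul_of_nonneg_left h2 (by norm_num)
    _ = _ := by rw [h3]; push_cast; ring

/-! ### Differencing of polynomials and moments of exponential sums. -/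

/-- The integer polynomial function with coefficients `c 0, …, c n`. -/
def intPoly (c : ℕ → ℤ) (n : ℕ) (m : ℤ) : ℤ := ∑ i ∈ Finset.range (n + 1), c i * m ^ i

/-- The coefficients of the difference quotient `(P(X + h) - P(X)) / h`, for `P` of degree at
most `n + 1` with coefficients `c`. -/
def diffCoeff (c : ℕ → ℤ) (n : ℕ) (h : ℤ) (j : ℕ) : ℤ :=
  ∑ i ∈ Finset.range (n + 2), if j < i then c i * i.choose j * h ^ (i - j - 1) else 0

theorem intPoly_add_sub (c : ℕ → ℤ) (n : ℕ) (h m : ℤ) :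
    intPoly c (n + 1) (m + h) - intPoly c (n + 1) m = h * intPoly (diffCoeff c n h) n m := by
  unfold intPoly diffCoeff
  simp_rw [Finset.sum_mul]
  rw [Finset.sum_comm, Finset.mul_sum, ← Finset.sum_sub_distrib]
  refine Finset.sum_congr rfl fun i hi => ?_
  rw [Finset.mem_range] at hi
  rw [add_pow, Finset.sum_range_succ, Finset.mul_sum]
  have hsub : Finset.range i ⊆ Finset.range (n + 1) := by
    intro j hj
    simp only [Finset.mem_range] at hj ⊢
    omega
  rw [← Finset.sum_subset hsub fun j _ hj => by
    rw [Finset.mem_range] at hj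
    rw [if_neg hj, zero_mul, mul_zero]]
  simp only [Nat.choose_self, Nat.sub_self, pow_zero, Nat.cast_one, mul_one]
  rw [mul_add, add_sub_cancel_right, Finset.mul_sum]
  refine Finset.sum_congr rfl fun j hj => ?_
  rw [Finset.mem_range] at hj
  rw [if_pos hj]
  have : i - j = (i - j - 1) + 1 := by omega
  rw [this, pow_succ, Nat.add_sub_cancel]
  ring

/-- The induction needs the leading coefficient to stay nonzero after differencing. -/
theorem diffCoeff_top (c : ℕ → ℤ) (n : ℕ) (h : ℤ) :
    diffCoeff c n h n = c (n + 1) * (n + 1) := by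
  rw [diffCoeff, Finset.sum_eq_single (n + 1)]
  · simp
  · intro i hi hi'
    rw [Finset.mem_range] at hi
    rw [if_neg (by omega)]
  · simp

/-- With `m` and `h` both of size `N`, the coefficients are homogeneous, and dividing by `h` lowers
the weight by one. The new constant does not depend on `h` or `N`, so the induction can run over all
`B`. -/
theorem abs_diffCoeff_le {c : ℕ → ℤ} {n N B : ℕ} {h : ℤ}
    (hc : ∀ i ≤ n + 1, |c i| ≤ B * (N : ℤ) ^ (n + 1 - i)) (hh : |h| ≤ 2 * N) {j : ℕ}
    (hj : j ≤ n) :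
    |diffCoeff c n h j| ≤ ((B * (n + 2) * 4 ^ (n + 1) : ℕ) : ℤ) * (N : ℤ) ^ (n - j) := by
  have key : ∀ i ∈ Finset.range (n + 2),
      |if j < i then c i * i.choose j * h ^ (i - j - 1) else 0| ≤
        B * 4 ^ (n + 1) * (N : ℤ) ^ (n - j) := by
    intro i hi
    rw [Finset.mem_range] at hi
    split_ifs with hji
    · have h1 : (i.choose j : ℤ) ≤ 2 ^ (n + 1) := by
        have := (Nat.choose_le_two_pow i j).trans
          (Nat.pow_le_pow_right two_pos (show i ≤ n + 1 by omega))
        exact_mod_cast this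
      have h2 : |h| ^ (i - j - 1) ≤ 2 ^ (n + 1) * (N : ℤ) ^ (i - j - 1) := by
        refine (pow_le_pow_left₀ (abs_nonneg h) hh _).trans ?_
        rw [mul_pow]
        exact mul_le_mul_of_nonneg_right
          (pow_le_pow_right₀ (by norm_num) (by omega)) (by positivity)
      rw [abs_mul, abs_mul, abs_pow, abs_of_nonneg (by positivity : (0 : ℤ) ≤ (i.choose j : ℤ))]
      have h3 : (N : ℤ) ^ (n - j) = (N : ℤ) ^ (n + 1 - i) * (N : ℤ) ^ (i - j - 1) := by
        rw [← pow_add]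
        congr 1
        omega
      have h4 : (4 : ℤ) ^ (n + 1) = 2 ^ (n + 1) * 2 ^ (n + 1) := by
        rw [← mul_pow]
        norm_num
      calc |c i| * (i.choose j : ℤ) * |h| ^ (i - j - 1)
          ≤ (B * (N : ℤ) ^ (n + 1 - i)) * 2 ^ (n + 1) *
            (2 ^ (n + 1) * (N : ℤ) ^ (i - j - 1)) := by
            gcongr
            exact hc i (by omega)
        _ = _ := by rw [h3, h4]; ring
    · simp only [abs_zero]
      positivity
  refine (Finset.abs_sum_le_sum_abs _ _).trans ((Finset.sum_le_sum key).trans (le_of_eq ?_))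
  simp only [Finset.sum_const, Finset.card_range, nsmul_eq_mul]
  push_cast
  ring

theorem sum_pow_le_card_pow_mul {ι : Type*} (s : Finset ι) (f : ι → ℝ) (hf : ∀ i ∈ s, 0 ≤ f i)
    {n : ℕ} (hn : 1 ≤ n) : (∑ i ∈ s, f i) ^ n ≤ (s.card : ℝ) ^ (n - 1) * ∑ i ∈ s, f i ^ n := by
  obtain ⟨n, rfl⟩ := Nat.exists_eq_add_of_le' hn
  rcases s.eq_empty_or_nonempty with rfl | hs
  · simp
  · have h0 : (0 : ℝ) < (s.card : ℝ) ^ n := by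
      have : 0 < s.card := hs.card_pos
      positivity
    have := pow_sum_div_card_le_sum_pow hf n
    rw [div_le_iff₀ h0] at this
    rw [Nat.add_sub_cancel]
    linarith

theorem sum_pow_three {α : Type*} (I : Finset α) (z : α → ℂ) :
    (∑ m ∈ I, z m) ^ 3 = ∑ τ ∈ I ×ˢ I ×ˢ I, z τ.1 * (z τ.2.1 * z τ.2.2) := by
  rw [pow_succ', sq, Finset.sum_mul_sum, ← Finset.sum_product', Finset.sum_mul_sum,
    ← Finset.sum_product']

theorem abs_intPoly_two_le {c : ℕ → ℤ} {N B : ℕ}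
    (hc : ∀ i ≤ 2, |c i| ≤ B * (N : ℤ) ^ (2 - i)) {m : ℤ} (hm : |m| ≤ N) :
    |intPoly c 2 m| ≤ 3 * B * (N : ℤ) ^ 2 := by
  have key : ∀ i ∈ Finset.range 3, |c i * m ^ i| ≤ B * (N : ℤ) ^ 2 := by
    intro i hi
    rw [Finset.mem_range] at hi
    rw [abs_mul, abs_pow]
    calc |c i| * |m| ^ i ≤ (B * (N : ℤ) ^ (2 - i)) * (N : ℤ) ^ i := by
          gcongr
          exact hc i (by omega)
      _ = B * (N : ℤ) ^ (2 - i + i) := by rw [pow_add]; ring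
      _ = _ := by rw [Nat.sub_add_cancel (by omega)]
  refine (Finset.abs_sum_le_sum_abs _ _).trans ((Finset.sum_le_sum key).trans (le_of_eq ?_))
  simp
  ring

/-- Cubing the sum makes its square a sixth power, with phases `P`, `R` summed over triples. As `r 1
≠ 0` and `c 2 ≠ 0`, a coincidence of `(P, R)` forces equal sums and equal sums of squares. Only `P`
needs a size bound, to count its values. -/
theorem exists_majorant_quadratic (B : ℕ) {N : ℕ} (hN : 1 ≤ N) (c r : ℕ → ℤ) (hc2 : c 2 ≠ 0)
    (hc : ∀ i ≤ 2, |c i| ≤ B * (N : ℤ) ^ (2 - i)) (hr : r 1 ≠ 0) (w : ℤ → ℂ)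
    (hw : ∀ m, ‖w m‖ ≤ 1) :
    ∃ F : ℝ → ℝ, Continuous F ∧
      (∀ μ l : ℝ, ‖∑ m ∈ Finset.Icc (-(N : ℤ)) N,
        w m * addExp (μ * intPoly c 2 m + l * intPoly r 1 m)‖ ^ 6 ≤ F l) ∧
      ∫ l in (0 : ℝ)..1, F l ≤ ((18 * B + 1) * 22464) * (N : ℝ) ^ (6 - 1 / 2 : ℝ) := by
  let P : ℤ × ℤ × ℤ → ℤ := fun τ => intPoly c 2 τ.1 + intPoly c 2 τ.2.1 + intPoly c 2 τ.2.2
  let R : ℤ × ℤ × ℤ → ℤ := fun τ => intPoly r 1 τ.1 + intPoly r 1 τ.2.1 + intPoly r 1 τ.2.2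
  let D : ℕ := 9 * B * N ^ 2
  obtain ⟨F, hF1, hF2, hF3⟩ := exists_majorant_sq (tripleBox N)
    (fun τ => w τ.1 * (w τ.2.1 * w τ.2.2))
    (fun τ _ => by
      rw [norm_mul, norm_mul]
      exact mul_le_one₀ (hw _) (by positivity) (mul_le_one₀ (hw _) (norm_nonneg _) (hw _)))
    P R (Finset.Icc (-(D : ℤ)) D) (fun τ hτ => by
      simp only [tripleBox, Finset.mem_product, Finset.mem_Icc, ← abs_le] at hτ ⊢
      have h1 := abs_intPoly_two_le hc hτ.1
      have h2 := abs_intPoly_two_le hc hτ.2.1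
      have h3 := abs_intPoly_two_le hc hτ.2.2
      have h4 := abs_add_three (intPoly c 2 τ.1) (intPoly c 2 τ.2.1) (intPoly c 2 τ.2.2)
      simp only [P, D]
      push_cast
      linarith)
  refine ⟨F, hF1, fun μ l => ?_, hF3.trans ?_⟩
  · refine le_trans (le_of_eq ?_) (hF2 μ l)
    rw [show 6 = 3 * 2 from rfl, pow_mul, ← norm_pow, sum_pow_three]
    congr 2
    refine Finset.sum_congr rfl fun τ _ => ?_
    have : μ * (P τ : ℝ) + l * (R τ : ℝ) =
        (μ * intPoly c 2 τ.1 + l * intPoly r 1 τ.1) +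
        ((μ * intPoly c 2 τ.2.1 + l * intPoly r 1 τ.2.1) +
        (μ * intPoly c 2 τ.2.2 + l * intPoly r 1 τ.2.2)) := by
      simp only [P, R]
      push_cast
      ring
    rw [this, addExp_add (_ + _) (_ + _ + _), addExp_add (_ + _) (_ + _)]
    ring
  · have hcount : ((((tripleBox N ×ˢ tripleBox N).filter
        fun x => P x.1 = P x.2 ∧ R x.1 = R x.2).card : ℕ) : ℝ) ≤
        22464 * (N : ℝ) ^ (7 / 2 : ℝ) := by
      refine le_trans ?_ (card_quadratic_system_le hN)
      refine Nat.cast_le.2 (Finset.card_le_card ?_)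
      rintro ⟨⟨m1, m2, m3⟩, ⟨n1, n2, n3⟩⟩ hx
      simp only [Finset.mem_filter, P, R, intPoly, Finset.sum_range_succ, Finset.sum_range_zero]
        at hx ⊢
      refine ⟨hx.1, ?_⟩
      obtain ⟨-, h1, h2⟩ := hx
      have h3 : m1 + m2 + m3 = n1 + n2 + n3 := by
        refine mul_left_cancel₀ hr ?_
        linear_combination h2
      refine ⟨h3, mul_left_cancel₀ hc2 ?_⟩
      linear_combination h1 - c 1 * h3
    have hV : ((Finset.Icc (-(D : ℤ)) D).card : ℝ) ≤ (18 * B + 1) * (N : ℝ) ^ 2 := by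
      rw [Int.card_Icc]
      have h1 : ((D : ℤ) + 1 - -(D : ℤ)).toNat = 2 * D + 1 := by omega
      rw [h1]
      have h2 : (1 : ℝ) ≤ (N : ℝ) ^ 2 := one_le_pow₀ (by exact_mod_cast hN)
      simp only [D]
      push_cast
      nlinarith
    have hN0 : (0 : ℝ) < N := by exact_mod_cast hN
    have hpow : (N : ℝ) ^ (6 - 1 / 2 : ℝ) = (N : ℝ) ^ 2 * (N : ℝ) ^ (7 / 2 : ℝ) := by
      rw [← Real.rpow_natCast, ← Real.rpow_add hN0]
      norm_num
    calc _ ≤ ((18 * B + 1) * (N : ℝ) ^ 2) * (22464 * (N : ℝ) ^ (7 / 2 : ℝ)) :=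
          mul_le_mul hV hcount (Nat.cast_nonneg _) (by positivity)
      _ = _ := by rw [hpow]; ring

/-- Van der Corput differencing for a sum over `[-N, N]`. -/
theorem norm_sq_sum_le_sum_diff (N : ℕ) (z : ℤ → ℂ) (hz : ∀ m, (N : ℤ) < |m| → z m = 0) :
    ‖∑ m ∈ Finset.Icc (-(N : ℤ)) N, z m‖ ^ 2 ≤ ∑ h ∈ Finset.Icc (-(2 * N : ℤ)) (2 * N),
      ‖∑ m ∈ Finset.Icc (-(N : ℤ)) N, z (m + h) * starRingEnd ℂ (z m)‖ := by
  have key : ((‖∑ m ∈ Finset.Icc (-(N : ℤ)) N, z m‖ ^ 2 : ℝ) : ℂ) =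
      ∑ h ∈ Finset.Icc (-(2 * N : ℤ)) (2 * N),
        ∑ m ∈ Finset.Icc (-(N : ℤ)) N, z (m + h) * starRingEnd ℂ (z m) := by
    rw [norm_sq_eq_sum_pairs, Finset.sum_product_right, Finset.sum_comm (s := Finset.Icc (-(2 * N : ℤ)) (2 * N))]
    refine Finset.sum_congr rfl fun m hm => ?_
    rw [Finset.mem_Icc] at hm
    have himg : (Finset.Icc (-(2 * N : ℤ)) (2 * N)).image (fun h => m + h) =
        Finset.Icc (m + -(2 * N : ℤ)) (m + 2 * N) := Finset.image_add_left_Icc _ _ _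
    have h1 : ∑ h ∈ Finset.Icc (-(2 * N : ℤ)) (2 * N), z (m + h) * starRingEnd ℂ (z m) =
        ∑ n ∈ Finset.Icc (m + -(2 * N : ℤ)) (m + 2 * N), z n * starRingEnd ℂ (z m) := by
      rw [← himg, Finset.sum_image fun _ _ _ _ h => add_left_cancel h]
    rw [h1]
    refine Finset.sum_subset (Finset.Icc_subset_Icc (by omega) (by omega)) fun n _ hn => ?_
    rw [Finset.mem_Icc, ← abs_le, not_le] at hn
    simp only [hz n hn, zero_mul]
  have h0 : ‖∑ m ∈ Finset.Icc (-(N : ℤ)) N, z m‖ ^ 2 =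
      ‖((‖∑ m ∈ Finset.Icc (-(N : ℤ)) N, z m‖ ^ 2 : ℝ) : ℂ)‖ := by
    rw [Complex.norm_real, Real.norm_eq_abs, abs_of_nonneg (by positivity)]
  rw [h0, key]
  exact norm_sum_le _ _

/-- A power mean estimate over `l ∈ [0, 1]`, uniform in `μ`, for exponential sums with phase
`μ P + l R`, where `P` has degree `k + 2` and size `O(N^(k+2))` on `[-N, N]`, and `R` has
degree `k + 1`. -/
theorem exists_majorant_exponential_sum (k : ℕ) : ∀ B : ℕ, ∃ C : ℝ, 0 < C ∧ ∀ N : ℕ, 1 ≤ N →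
    ∀ c r : ℕ → ℤ, c (k + 2) ≠ 0 → (∀ i ≤ k + 2, |c i| ≤ B * (N : ℤ) ^ (k + 2 - i)) →
    r (k + 1) ≠ 0 → ∀ w : ℤ → ℂ, (∀ m, ‖w m‖ ≤ 1) → (∀ m, (N : ℤ) < |m| → w m = 0) →
    ∃ F : ℝ → ℝ, Continuous F ∧
      (∀ μ l : ℝ, ‖∑ m ∈ Finset.Icc (-(N : ℤ)) N,
        w m * addExp (μ * intPoly c (k + 2) m + l * intPoly r (k + 1) m)‖ ^ (6 * 2 ^ k) ≤ F l) ∧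
      ∫ l in (0 : ℝ)..1, F l ≤ C * (N : ℝ) ^ (((6 * 2 ^ k : ℕ) : ℝ) - 1 / 2) := by
  induction k with
  | zero =>
    intro B
    refine ⟨(18 * B + 1) * 22464, by positivity, fun N hN c r hc2 hc hr w hw _ => ?_⟩
    obtain ⟨F, h1, h2, h3⟩ := exists_majorant_quadratic B hN c r hc2 hc hr w hw
    refine ⟨F, h1, by simpa using h2, by simpa using h3⟩
  | succ k ih =>
    intro B
    obtain ⟨C, hC, ih⟩ := ih (B * (k + 2 + 2) * 4 ^ (k + 2 + 1))
    set s := 6 * 2 ^ k with hs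
    have hs1 : 1 ≤ s := by
      have : 0 < 2 ^ k := by positivity
      omega
    have hs2 : 6 * 2 ^ (k + 1) = 2 * s := by rw [hs]; ring
    rw [hs2]
    refine ⟨15 ^ s + 5 ^ s * C, by positivity, fun N hN c r hc2 hc hr w hw hw0 => ?_⟩
    have hNr : (1 : ℝ) ≤ N := by exact_mod_cast hN
    have step : ∀ h : ℤ, |h| ≤ 2 * N → ∃ F : ℝ → ℝ, Continuous F ∧
        (∀ μ l : ℝ, ‖∑ m ∈ Finset.Icc (-(N : ℤ)) N, (w (m + h) * starRingEnd ℂ (w m)) *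
          addExp (μ * (h * intPoly (diffCoeff c (k + 2) h) (k + 2) m) +
            l * (h * intPoly (diffCoeff r (k + 1) h) (k + 1) m))‖ ^ s ≤ F l) ∧
        ∫ l in (0 : ℝ)..1, F l ≤
          C * (N : ℝ) ^ ((s : ℝ) - 1 / 2) + if h = 0 then (3 * (N : ℝ)) ^ s else 0 := by
      intro h hh
      have hwh : ∀ m, ‖w (m + h) * starRingEnd ℂ (w m)‖ ≤ 1 := by
        intro m
        rw [norm_mul, RCLike.norm_conj]
        exact mul_le_one₀ (hw _) (norm_nonneg _) (hw _)
      by_cases h0 : h = 0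
      -- The diagonal displacement has no oscillation, but it is one of about `4N` and so can be
      -- bounded trivially.
      · refine ⟨fun _ => (3 * (N : ℝ)) ^ s, continuous_const, fun μ l => ?_, ?_⟩
        · refine pow_le_pow_left₀ (norm_nonneg _) ?_ _
          refine (norm_sum_le_of_le (n := fun _ => (1 : ℝ)) _ fun m _ => ?_).trans ?_
          · rw [norm_mul, norm_addExp, mul_one]
            exact hwh m
          · rw [Finset.sum_const, nsmul_eq_mul, mul_one, Int.card_Icc]
            have : ((N : ℤ) + 1 - -(N : ℤ)).toNat ≤ 3 * N := by omega
            exact_mod_cast this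
        · simp only [h0, if_true, intervalIntegral.integral_const, sub_zero, one_smul]
          have : 0 ≤ C * (N : ℝ) ^ ((s : ℝ) - 1 / 2) := by positivity
          linarith
      -- In the `P` part the factor `h` is moved into `μ`, which is harmless by uniformity and keeps
      -- the coefficients small. In the `R` part it must go into the coefficients, as `l` is
      -- integrated; these need no size bound.
      · obtain ⟨F, hF1, hF2, hF3⟩ := ih N hN (diffCoeff c (k + 2) h)
          (fun j => h * diffCoeff r (k + 1) h j)
          (by
            rw [diffCoeff_top]
            exact mul_ne_zero hc2 (by positivity))
          (fun j hj => abs_diffCoeff_le hc hh hj)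
          (by
            rw [diffCoeff_top]
            exact mul_ne_zero h0 (mul_ne_zero hr (by positivity)))
          (fun m => w (m + h) * starRingEnd ℂ (w m)) hwh
          (fun m hm => by rw [hw0 m hm, map_zero, mul_zero])
        refine ⟨F, hF1, fun μ l => ?_, by rwa [if_neg h0, add_zero]⟩
        refine le_trans (le_of_eq ?_) (hF2 (μ * h) l)
        congr 2
        refine Finset.sum_congr rfl fun m _ => ?_
        congr 2
        have : intPoly (fun j => h * diffCoeff r (k + 1) h j) (k + 1) m =
            h * intPoly (diffCoeff r (k + 1) h) (k + 1) m := by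
          simp only [intPoly, Finset.mul_sum, mul_assoc]
        rw [this]
        push_cast
        ring
    choose! F hF1 hF2 hF3 using step
    set H := Finset.Icc (-(2 * N : ℤ)) (2 * N) with hH
    have hHm : ∀ h ∈ H, |h| ≤ 2 * N := fun h hh => by
      rw [hH, Finset.mem_Icc, ← abs_le] at hh
      exact hh
    have hHc : (H.card : ℝ) ≤ 5 * N := by
      rw [hH, Int.card_Icc]
      have : ((2 * N : ℤ) + 1 - -(2 * N : ℤ)).toNat ≤ 5 * N := by omega
      exact_mod_cast this
    have hH0 : (0 : ℤ) ∈ H := by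
      rw [hH, Finset.mem_Icc]
      omega
    have hFcont : Continuous fun l => ∑ h ∈ H, F h l :=
      continuous_finsetSum _ fun h hh => hF1 h (hHm h hh)
    -- Power mean over the at most `5N` displacements, applied to the `s`-th power of the
    -- differenced bound.
    refine ⟨fun l => (5 * (N : ℝ)) ^ (s - 1) * ∑ h ∈ H, F h l, continuous_const.mul hFcont,
      fun μ l => ?_, ?_⟩
    · rw [pow_mul]
      have h1 := norm_sq_sum_le_sum_diff N
        (fun m => w m * addExp (μ * intPoly c (k + 1 + 2) m + l * intPoly r (k + 1 + 1) m))
        (fun m hm => by rw [hw0 m hm, zero_mul])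
      refine (pow_le_pow_left₀ (by positivity) h1 s).trans ?_
      refine (sum_pow_le_card_pow_mul _ _ (fun _ _ => norm_nonneg _) hs1).trans ?_
      refine mul_le_mul (pow_le_pow_left₀ (by positivity) hHc _)
        (Finset.sum_le_sum fun h hh => ?_) (Finset.sum_nonneg fun _ _ => by positivity)
        (by positivity)
      refine le_trans (le_of_eq ?_) (hF2 h (hHm h hh) μ l)
      congr 2
      refine Finset.sum_congr rfl fun m _ => ?_
      have h2 := intPoly_add_sub c (k + 2) h m
      have h3 := intPoly_add_sub r (k + 1) h m
      have h2' : (intPoly c (k + 1 + 2) (m + h) : ℝ) - intPoly c (k + 1 + 2) m =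
          h * intPoly (diffCoeff c (k + 2) h) (k + 2) m := by exact_mod_cast h2
      have h3' : (intPoly r (k + 1 + 1) (m + h) : ℝ) - intPoly r (k + 1 + 1) m =
          h * intPoly (diffCoeff r (k + 1) h) (k + 1) m := by exact_mod_cast h3
      rw [← h2', ← h3', map_mul, conj_addExp]
      have h4 : μ * ((intPoly c (k + 1 + 2) (m + h) : ℝ) - intPoly c (k + 1 + 2) m) +
          l * ((intPoly r (k + 1 + 1) (m + h) : ℝ) - intPoly r (k + 1 + 1) m) =
          (μ * intPoly c (k + 1 + 2) (m + h) + l * intPoly r (k + 1 + 1) (m + h)) +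
          -(μ * intPoly c (k + 1 + 2) m + l * intPoly r (k + 1 + 1) m) := by ring
      rw [h4, addExp_add (_ + _) (-_)]
      ring
    · rw [intervalIntegral.integral_const_mul, intervalIntegral.integral_finsetSum
        fun h hh => (hF1 h (hHm h hh)).intervalIntegrable _ _]
      have hN0 : (0 : ℝ) < N := by positivity
      have h1 : ∑ h ∈ H, ∫ l in (0 : ℝ)..1, F h l ≤
          5 * N * (C * (N : ℝ) ^ ((s : ℝ) - 1 / 2)) + (3 * (N : ℝ)) ^ s := by
        refine (Finset.sum_le_sum fun h hh => hF3 h (hHm h hh)).trans ?_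
        rw [Finset.sum_add_distrib, Finset.sum_const, nsmul_eq_mul, Finset.sum_ite_eq' H,
          if_pos hH0]
        gcongr
      obtain ⟨t, ht⟩ := Nat.exists_eq_add_of_le' hs1
      have e1 : (N : ℝ) ^ (((2 * s : ℕ) : ℝ) - 1 / 2) =
          (N : ℝ) ^ s * (N : ℝ) ^ ((s : ℝ) - 1 / 2) := by
        rw [← Real.rpow_natCast, ← Real.rpow_add hN0]
        congr 1
        push_cast
        ring
      have e2 : (N : ℝ) ^ t ≤ (N : ℝ) ^ ((s : ℝ) - 1 / 2) := by
        rw [← Real.rpow_natCast]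
        refine Real.rpow_le_rpow_of_exponent_le hNr ?_
        rw [ht]
        push_cast
        linarith
      have e3 : s - 1 = t := by omega
      rw [e3, e1]
      have e4 : (15 : ℝ) ^ s = 5 ^ s * 3 ^ s := by
        rw [← mul_pow]
        norm_num
      have e5 : (5 : ℝ) ^ t ≤ 5 ^ s := pow_le_pow_right₀ (by norm_num) (by omega)
      calc _ ≤ (5 * (N : ℝ)) ^ t *
            (5 * N * (C * (N : ℝ) ^ ((s : ℝ) - 1 / 2)) + (3 * (N : ℝ)) ^ s) := by gcongr
        _ = (5 * (N : ℝ)) ^ (t + 1) * (C * (N : ℝ) ^ ((s : ℝ) - 1 / 2)) +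
            5 ^ t * 3 ^ s * (N : ℝ) ^ s * (N : ℝ) ^ t := by
            rw [mul_pow 3]
            ring
        _ ≤ (5 * (N : ℝ)) ^ s * (C * (N : ℝ) ^ ((s : ℝ) - 1 / 2)) +
            5 ^ s * 3 ^ s * (N : ℝ) ^ s * (N : ℝ) ^ ((s : ℝ) - 1 / 2) := by
            rw [← ht]
            gcongr
        _ = _ := by rw [e4, mul_pow]; ring

/-! ### Correlation kernels and the exceptional parameters. -/

/-- The kernel `1/m` restricted to the shell `N ≤ |m| < 2N`. -/
noncomputable def shellKernel (N : ℕ) (m : ℤ) : ℂ :=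
  if (N : ℤ) ≤ |m| ∧ |m| < 2 * N then (m : ℂ)⁻¹ else 0

theorem shellKernel_eq_zero {N : ℕ} {m : ℤ} (h : (2 * N : ℤ) < |m|) : shellKernel N m = 0 :=
  if_neg fun h' => by omega

theorem norm_shellKernel_le {N : ℕ} (hN : 1 ≤ N) (m : ℤ) : ‖shellKernel N m‖ ≤ (N : ℝ)⁻¹ := by
  unfold shellKernel
  split_ifs with h
  · rw [norm_inv, Complex.norm_intCast]
    have h1 : (N : ℝ) ≤ |(m : ℝ)| := by exact_mod_cast h.1
    have h0 : (0 : ℝ) < N := by exact_mod_cast hN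
    exact inv_anti₀ h0 h1
  · simp

theorem conj_shellKernel (N : ℕ) (m : ℤ) : starRingEnd ℂ (shellKernel N m) = shellKernel N m := by
  unfold shellKernel
  split_ifs <;> simp

/-- The `TT*` kernel of the truncated oscillatory sum on the shell `N ≤ |m| < 2N`, at
displacement `h`, with modulation parameters `ν` and `l`. -/
noncomputable def shellCorrelation (d N : ℕ) (ν l : ℝ) (h : ℤ) : ℂ :=
  ∑ m ∈ Finset.Icc (-(2 * N : ℤ)) (2 * N),
    shellKernel N m * shellKernel N (m - h) * addExp (ν * (m : ℝ) ^ d - l * ((m - h : ℤ) : ℝ) ^ d)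

theorem intPoly_single (n : ℕ) (m : ℤ) : intPoly (fun i => if i = n then 1 else 0) n m = m ^ n := by
  simp [intPoly]

/-- Majorant for a single displacement. -/
theorem exists_majorant_shellCorrelation (k : ℕ) : ∃ C : ℝ, 0 < C ∧ ∀ N : ℕ, 1 ≤ N →
    ∀ h : ℤ, h ≠ 0 → ∃ F : ℝ → ℝ, Continuous F ∧
      (∀ ν l : ℝ, ((N : ℝ) ^ 2 * ‖shellCorrelation (k + 2) N ν l h‖) ^ (6 * 2 ^ k) ≤ F l) ∧
      ∫ l in (0 : ℝ)..1, F l ≤ C * (N : ℝ) ^ (((6 * 2 ^ k : ℕ) : ℝ) - 1 / 2) := by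
  obtain ⟨C, hC, hmaj⟩ := exists_majorant_exponential_sum k 1
  set s := 6 * 2 ^ k
  refine ⟨C * 2 ^ ((s : ℝ) - 1 / 2), by positivity, fun N hN h hh => ?_⟩
  have hN0 : (0 : ℝ) < N := by exact_mod_cast hN
  let c : ℕ → ℤ := fun i => if i = k + 2 then 1 else 0
  -- Here `P = m ^ (k + 2)` and `R = m ^ (k + 2) - (m - h) ^ (k + 2)`, whose top coefficient is a
  -- nonzero multiple of `h`; the factor `N ^ 2` normalises the weights.
  obtain ⟨F, hF1, hF2, hF3⟩ := hmaj (2 * N) (by omega) c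
    (fun j => h * diffCoeff c (k + 1) (-h) j) (by simp [c])
    (fun i hi => by
      simp only [c]
      split_ifs with h1
      · simp [h1]
      · rw [abs_zero]
        positivity)
    (by
      rw [diffCoeff_top]
      refine mul_ne_zero hh (mul_ne_zero (by simp [c]) (by positivity)))
    (fun m => (N : ℂ) ^ 2 * (shellKernel N m * shellKernel N (m - h)))
    (fun m => by
      rw [norm_mul, norm_mul, norm_pow, Complex.norm_natCast]
      have h1 := norm_shellKernel_le hN m
      have h2 := norm_shellKernel_le hN (m - h)
      calc (N : ℝ) ^ 2 * (‖shellKernel N m‖ * ‖shellKernel N (m - h)‖)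
          ≤ (N : ℝ) ^ 2 * ((N : ℝ)⁻¹ * (N : ℝ)⁻¹) := by gcongr
        _ = 1 := by field_simp)
    (fun m hm => by
      push_cast at hm
      rw [shellKernel_eq_zero hm, zero_mul, mul_zero])
  refine ⟨F, hF1, fun ν l => ?_, hF3.trans (le_of_eq ?_)⟩
  · refine le_trans (le_of_eq ?_) (hF2 (ν - l) l)
    congr 1
    rw [← Complex.norm_natCast N, ← norm_pow, ← norm_mul, shellCorrelation, Finset.mul_sum]
    congr 1
    push_cast
    refine Finset.sum_congr rfl fun m _ => ?_
    have h1 : intPoly (fun j => h * diffCoeff c (k + 1) (-h) j) (k + 1) m =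
        m ^ (k + 2) - (m - h) ^ (k + 2) := by
      have h2 := intPoly_add_sub c (k + 1) (-h) m
      rw [intPoly_single, intPoly_single] at h2
      have h3 : intPoly (fun j => h * diffCoeff c (k + 1) (-h) j) (k + 1) m =
          h * intPoly (diffCoeff c (k + 1) (-h)) (k + 1) m := by
        simp only [intPoly, Finset.mul_sum, mul_assoc]
      rw [h3, sub_eq_add_neg m h]
      linear_combination h2
    rw [h1, intPoly_single]
    rw [mul_assoc, mul_assoc, mul_assoc]
    congr 4
    push_cast
    ring
  · push_cast
    rw [Real.mul_rpow (by norm_num) hN0.le]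
    ring

/-- Off a small set of `l ∈ [0, 1]`, the correlation kernels have small absolute sum over all
nonzero displacements, uniformly in the other modulation parameters. -/
theorem exists_exceptional_set {d : ℕ} (hd : 2 ≤ d) : ∃ C δ : ℝ, 0 < C ∧ 0 < δ ∧ δ ≤ 1 ∧
    ∀ N : ℕ, 1 ≤ N → ∃ S : Set ℝ, MeasurableSet S ∧ S ⊆ Set.Icc 0 1 ∧
      volume S ≤ ENNReal.ofReal (C * (N : ℝ) ^ (-(1 / 4) : ℝ)) ∧
      ∀ l ∈ Set.Icc (0 : ℝ) 1 \ S, ∀ ν : ℤ → ℝ,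
        ∑ h ∈ (Finset.Icc (-(N : ℤ)) N).erase 0, ‖shellCorrelation d N (ν h) l h‖ ≤
          C * (N : ℝ) ^ (-δ) := by
  obtain ⟨k, rfl⟩ := Nat.exists_eq_add_of_le' hd
  obtain ⟨C, hC, hmaj⟩ := exists_majorant_shellCorrelation k
  set s := 6 * 2 ^ k with hs
  have hs1 : 1 ≤ s := by
    have : 0 < 2 ^ k := by positivity
    omega
  have hs1' : (1 : ℝ) ≤ s := by exact_mod_cast hs1
  refine ⟨max (2 * C) 2, 1 / (4 * s), by positivity, by positivity, ?_, fun N hN => ?_⟩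
  · rw [div_le_one (by positivity)]
    linarith
  have hN0 : (0 : ℝ) < N := by exact_mod_cast hN
  set H := (Finset.Icc (-(N : ℤ)) N).erase 0 with hH
  have hHc : (H.card : ℝ) ≤ 2 * N := by
    rw [hH, Finset.card_erase_of_mem (by simp), Int.card_Icc]
    have : ((N : ℤ) + 1 - -(N : ℤ)).toNat - 1 ≤ 2 * N := by omega
    exact_mod_cast this
  have hmaj' := hmaj N hN
  choose! F hF1 hF2 hF3 using hmaj'
  have hH0 : ∀ h ∈ H, h ≠ 0 := fun h hh => (Finset.mem_erase.1 hh).1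
  let G : ℝ → ℝ := fun l => ∑ h ∈ H, F h l
  have hGc : Continuous G := continuous_finsetSum _ fun h hh => hF1 h (hH0 h hh)
  have hG0 : ∀ l, 0 ≤ G l := fun l => Finset.sum_nonneg fun h hh =>
    le_trans (by positivity) (hF2 h (hH0 h hh) 0 l)
  -- The mean of `G` is `O(N ^ (s + 1/2))`, so this threshold gives measure `O(N ^ (-1/4))`. It is
  -- still `N ^ (1/4)` below the trivial size `N ^ (s + 1)`, and an `s`-th root yields the exponent
  -- `1 / (4 s)`.
  set τ : ℝ := (N : ℝ) ^ ((s : ℝ) + 3 / 4) with hτ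
  have hτ0 : 0 < τ := by positivity
  have hGi : ∫ l in Set.Icc (0 : ℝ) 1, G l ≤ 2 * C * (N : ℝ) ^ ((s : ℝ) + 1 / 2) := by
    rw [integral_Icc_eq_integral_Ioc, ← intervalIntegral.integral_of_le zero_le_one,
      intervalIntegral.integral_finsetSum
        fun h hh => (hF1 h (hH0 h hh)).intervalIntegrable _ _]
    refine (Finset.sum_le_sum fun h hh => hF3 h (hH0 h hh)).trans ?_
    rw [Finset.sum_const, nsmul_eq_mul]
    have : (N : ℝ) ^ ((s : ℝ) + 1 / 2) = N * (N : ℝ) ^ ((s : ℝ) - 1 / 2) := by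
      rw [← Real.rpow_one_add' hN0.le (by linarith)]
      congr 1
      ring
    rw [this]
    calc _ ≤ (2 * N) * (C * (N : ℝ) ^ ((s : ℝ) - 1 / 2)) := by gcongr
      _ = _ := by ring
  refine ⟨Set.Icc 0 1 ∩ {l | τ ≤ G l},
    measurableSet_Icc.inter (measurableSet_le measurable_const hGc.measurable),
    Set.inter_subset_left, ?_, ?_⟩
  · have h1 := mul_meas_ge_le_integral_of_nonneg (μ := volume.restrict (Set.Icc (0 : ℝ) 1))
      (Filter.Eventually.of_forall hG0) (hGc.integrableOn_Icc) τ
    rw [measureReal_restrict_apply (measurableSet_le measurable_const hGc.measurable),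
      Set.inter_comm] at h1
    have hfin : volume (Set.Icc (0 : ℝ) 1 ∩ {l | τ ≤ G l}) ≠ ∞ :=
      ((measure_mono Set.inter_subset_left).trans_lt (by simp)).ne
    rw [← ENNReal.ofReal_toReal hfin]
    refine ENNReal.ofReal_le_ofReal ?_
    change volume.real _ ≤ _
    have h2 : (N : ℝ) ^ ((s : ℝ) + 1 / 2) = τ * (N : ℝ) ^ (-(1 / 4) : ℝ) := by
      rw [hτ, ← Real.rpow_add hN0]
      congr 1
      ring
    have h3 := h1.trans hGi
    rw [h2] at h3
    have h4 : volume.real (Set.Icc (0 : ℝ) 1 ∩ {l | τ ≤ G l}) ≤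
        2 * C * (N : ℝ) ^ (-(1 / 4) : ℝ) := by
      refine le_of_mul_le_mul_left (h3.trans (le_of_eq ?_)) hτ0
      ring
    exact h4.trans (mul_le_mul_of_nonneg_right (le_max_left _ _) (by positivity))
  · intro l hl ν
    have hl' : G l < τ := by
      by_contra hcon
      exact hl.2 ⟨hl.1, not_lt.1 hcon⟩
    have h1 : (∑ h ∈ H, (N : ℝ) ^ 2 * ‖shellCorrelation (k + 2) N (ν h) l h‖) ^ s ≤
        (2 * (N : ℝ) ^ ((2 : ℝ) - 1 / (4 * s))) ^ s := by
      refine (sum_pow_le_card_pow_mul _ _ (fun _ _ => by positivity) hs1).trans ?_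
      have h2 : ∑ h ∈ H, ((N : ℝ) ^ 2 * ‖shellCorrelation (k + 2) N (ν h) l h‖) ^ s ≤ τ :=
        (Finset.sum_le_sum fun h hh => hF2 h (hH0 h hh) (ν h) l).trans hl'.le
      have h3 : ((N : ℝ) ^ ((2 : ℝ) - 1 / (4 * s))) ^ s = (N : ℝ) ^ (s - 1) * τ := by
        rw [hτ, ← Real.rpow_natCast, ← Real.rpow_natCast, ← Real.rpow_mul hN0.le,
          ← Real.rpow_add hN0, Nat.cast_sub hs1]
        congr 1
        field_simp
        push_cast
        ring
      calc _ ≤ (2 * (N : ℝ)) ^ (s - 1) * τ := by gcongr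
        _ = 2 ^ (s - 1) * ((N : ℝ) ^ (s - 1) * τ) := by rw [mul_pow]; ring
        _ ≤ 2 ^ s * ((N : ℝ) ^ (s - 1) * τ) := by
          gcongr
          · norm_num
          · omega
        _ = _ := by rw [mul_pow, h3]
    have h2 := le_of_pow_le_pow_left₀ (by omega) (by positivity) h1
    rw [← Finset.mul_sum] at h2
    have h3 : (N : ℝ) ^ ((2 : ℝ) - 1 / (4 * s)) = (N : ℝ) ^ 2 * (N : ℝ) ^ (-(1 / (4 * s)) : ℝ) := by
      rw [← Real.rpow_natCast, ← Real.rpow_add hN0]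
      congr 1
    rw [h3] at h2
    have h4 : ∑ h ∈ H, ‖shellCorrelation (k + 2) N (ν h) l h‖ ≤
        2 * (N : ℝ) ^ (-(1 / (4 * s)) : ℝ) := by
      refine le_of_mul_le_mul_left (h2.trans (le_of_eq ?_)) (by positivity : (0 : ℝ) < (N : ℝ) ^ 2)
      ring
    exact h4.trans (mul_le_mul_of_nonneg_right (le_max_right _ _) (by positivity))

/-! ### `TT*` bounds for shell sums. -/

/-- The part of the modulated Hilbert transform coming from the shell `N ≤ |m| < 2N`. -/
noncomputable def shellSum (d N : ℕ) (t : ℝ) (f : ℤ → ℂ) (x : ℤ) : ℂ :=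
  ∑ m ∈ Finset.Icc (-(2 * N : ℤ)) (2 * N),
    shellKernel N m * addExp (t * (m : ℝ) ^ d) * f (x - m)

/-- Change of variables `y = x - m` in a sum over a neighbourhood of `[a, a + N)`. -/
theorem sum_reflect {N : ℕ} {a x : ℤ} (hx : x ∈ Finset.Ico a (a + N)) (φ : ℤ → ℂ)
    (hφ : ∀ m, (2 * N : ℤ) < |m| → φ m = 0) :
    ∑ m ∈ Finset.Icc (-(2 * N : ℤ)) (2 * N), φ m =
      ∑ y ∈ Finset.Icc (a - 2 * N) (a + 3 * N), φ (x - y) := by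
  rw [Finset.mem_Ico] at hx
  have himg : (Finset.Icc (-(2 * N : ℤ)) (2 * N)).image (fun m => x - m) ⊆
      Finset.Icc (a - 2 * N) (a + 3 * N) := by
    intro y hy
    simp only [Finset.mem_image, Finset.mem_Icc] at hy ⊢
    omega
  rw [← Finset.sum_subset himg]
  · rw [Finset.sum_image fun m _ n _ h => sub_right_injective h]
    exact Finset.sum_congr rfl fun m _ => by rw [sub_sub_cancel]
  · intro y _ hy
    refine hφ _ (not_le.1 fun h => hy (Finset.mem_image.2 ⟨x - y, ?_, by ring⟩))
    rwa [Finset.mem_Icc, ← abs_le]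

theorem shellSum_eq_sum {d N : ℕ} {a x : ℤ} (hx : x ∈ Finset.Ico a (a + N)) (t : ℝ)
    (f : ℤ → ℂ) : shellSum d N t f x = ∑ y ∈ Finset.Icc (a - 2 * N) (a + 3 * N),
      shellKernel N (x - y) * addExp (t * ((x - y : ℤ) : ℝ) ^ d) * f y := by
  have h := sum_reflect hx
    (fun m => shellKernel N m * addExp (t * (m : ℝ) ^ d) * f (x - m))
    (fun m hm => by rw [shellKernel_eq_zero hm, zero_mul, zero_mul])
  rw [shellSum, h]
  exact Finset.sum_congr rfl fun y _ => by rw [sub_sub_cancel]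

theorem norm_shellSum_le {d N : ℕ} (hN : 1 ≤ N) {a x : ℤ} (hx : x ∈ Finset.Ico a (a + N)) (t : ℝ)
    (f : ℤ → ℂ) : ‖shellSum d N t f x‖ ≤
      (N : ℝ)⁻¹ * ∑ y ∈ Finset.Icc (a - 2 * N) (a + 3 * N), ‖f y‖ := by
  rw [shellSum_eq_sum hx, Finset.mul_sum]
  refine norm_sum_le_of_le _ fun y _ => ?_
  rw [norm_mul, norm_mul, norm_addExp, mul_one]
  exact mul_le_mul_of_nonneg_right (norm_shellKernel_le hN _) (norm_nonneg _)

theorem norm_shellSum_le_of_bounded {d N : ℕ} (hN : 1 ≤ N) (t : ℝ) (f : ℤ → ℂ)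
    (hf : ∀ y, ‖f y‖ ≤ 1) (x : ℤ) : ‖shellSum d N t f x‖ ≤ 5 := by
  have hN0 : (0 : ℝ) < N := by exact_mod_cast hN
  refine (norm_sum_le_of_le (n := fun _ => (N : ℝ)⁻¹) _ fun m _ => ?_).trans ?_
  · rw [norm_mul, norm_mul, norm_addExp, mul_one, ← mul_one (N : ℝ)⁻¹]
    exact mul_le_mul (norm_shellKernel_le hN _) (hf _) (norm_nonneg _) (by positivity)
  · rw [Finset.sum_const, nsmul_eq_mul, Int.card_Icc]
    have h1 : ((2 * N : ℤ) + 1 - -(2 * N : ℤ)).toNat ≤ 5 * N := by omega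
    have h2 : ((((2 * N : ℤ) + 1 - -(2 * N : ℤ)).toNat : ℕ) : ℝ) ≤ 5 * N := by exact_mod_cast h1
    rw [← div_eq_mul_inv, div_le_iff₀ hN0]
    exact h2

theorem norm_shellCorrelation_le {d N : ℕ} (hN : 1 ≤ N) (ν l : ℝ) (h : ℤ) :
    ‖shellCorrelation d N ν l h‖ ≤ 5 * (N : ℝ)⁻¹ := by
  have hN0 : (0 : ℝ) < N := by exact_mod_cast hN
  refine (norm_sum_le_of_le (n := fun _ => (N : ℝ)⁻¹ * (N : ℝ)⁻¹) _ fun m _ => ?_).trans ?_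
  · rw [norm_mul, norm_mul, norm_addExp, mul_one]
    exact mul_le_mul (norm_shellKernel_le hN _) (norm_shellKernel_le hN _) (norm_nonneg _)
      (by positivity)
  · rw [Finset.sum_const, nsmul_eq_mul, Int.card_Icc]
    have h1 : ((2 * N : ℤ) + 1 - -(2 * N : ℤ)).toNat ≤ 5 * N := by omega
    have h2 : ((((2 * N : ℤ) + 1 - -(2 * N : ℤ)).toNat : ℕ) : ℝ) ≤ 5 * N := by exact_mod_cast h1
    calc _ ≤ (5 * N) * ((N : ℝ)⁻¹ * (N : ℝ)⁻¹) := by gcongr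
      _ = _ := by field_simp

/-- Identifies the kernel of `TT*` when different rows carry different parameters. -/
theorem sum_kernel_mul_conj_kernel {d N : ℕ} {a x x' : ℤ} (hx : x ∈ Finset.Ico a (a + N))
    (ν l : ℝ) :
    ∑ y ∈ Finset.Icc (a - 2 * N) (a + 3 * N),
      (shellKernel N (x - y) * addExp (ν * ((x - y : ℤ) : ℝ) ^ d)) *
        starRingEnd ℂ (shellKernel N (x' - y) * addExp (l * ((x' - y : ℤ) : ℝ) ^ d)) =
      shellCorrelation d N ν l (x - x') := by
  rw [shellCorrelation, sum_reflect hx _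
    (fun m hm => by rw [shellKernel_eq_zero hm, zero_mul, zero_mul])]
  refine Finset.sum_congr rfl fun y _ => ?_
  have h1 : x - y - (x - x') = x' - y := by ring
  rw [h1, map_mul, conj_addExp, conj_shellKernel, sub_eq_add_neg (ν * _), addExp_add]
  ring

/-- `TT*`: an `ℓ²` bound for linearised shell sums from a bound for the correlations. -/
theorem sum_norm_sq_shellSum_le {d N : ℕ} (hN : 1 ≤ N) {κ : ℝ} (t : ℤ → ℝ)
    (ht : ∀ x : ℤ, ∀ ν : ℤ → ℝ, ∑ h ∈ (Finset.Icc (-(N : ℤ)) N).erase 0,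
      ‖shellCorrelation d N (ν h) (t x) h‖ ≤ κ) (g : ℤ → ℂ) (hg : ∀ y, ‖g y‖ ≤ 1) (a : ℤ) :
    (∑ x ∈ Finset.Ico a (a + N), ‖shellSum d N (t x) g x‖ ^ 2) ^ 2 ≤
      (150 * (N : ℝ) ^ 2) * (κ + 5 * (N : ℝ)⁻¹) := by
  have hN0 : (0 : ℝ) < N := by exact_mod_cast hN
  set I := Finset.Ico a (a + N) with hI
  set J := Finset.Icc (a - 2 * N) (a + 3 * N) with hJ
  let v : ℤ → ℂ := fun x => shellSum d N (t x) g x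
  have hv : ∀ x, ‖v x‖ ≤ 5 := fun x => norm_shellSum_le_of_bounded hN _ _ hg x
  let K : ℤ → ℤ → ℂ := fun x y => shellKernel N (x - y) * addExp (t x * ((x - y : ℤ) : ℝ) ^ d)
  let W : ℤ → ℂ := fun y => ∑ x ∈ I, starRingEnd ℂ (v x) * K x y
  set A := ∑ x ∈ I, ‖v x‖ ^ 2 with hA
  have hA0 : 0 ≤ A := Finset.sum_nonneg fun _ _ => by positivity
  -- Duality: `A` pairs `g` with the adjoint applied to `v`. As `g` is bounded by one, only the `ℓ²`
  -- size of `W` matters, and expanding it produces the correlations.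
  have h1 : (A : ℂ) = ∑ y ∈ J, W y * g y := by
    simp only [W, Finset.sum_mul]
    rw [Finset.sum_comm, hA, Complex.ofReal_sum]
    refine Finset.sum_congr rfl fun x hx => ?_
    have : v x = ∑ y ∈ J, K x y * g y := shellSum_eq_sum hx _ _
    rw [Complex.ofReal_pow, ← Complex.conj_mul']
    nth_rewrite 2 [this]
    rw [Finset.mul_sum]
    exact Finset.sum_congr rfl fun y _ => by ring
  have h2 : A ≤ ∑ y ∈ J, ‖W y‖ := by
    have : A = ‖(A : ℂ)‖ := by rw [Complex.norm_real, Real.norm_eq_abs, abs_of_nonneg hA0]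
    rw [this, h1]
    refine norm_sum_le_of_le _ fun y _ => ?_
    rw [norm_mul]
    exact mul_le_of_le_one_right (norm_nonneg _) (hg y)
  have hJc : (J.card : ℝ) ≤ 6 * N := by
    rw [hJ, Int.card_Icc]
    have : (a + 3 * N + 1 - (a - 2 * N)).toNat ≤ 6 * N := by omega
    exact_mod_cast this
  have h3 : A ^ 2 ≤ 6 * N * ∑ y ∈ J, ‖W y‖ ^ 2 :=
    (pow_le_pow_left₀ hA0 h2 2).trans (sq_sum_le_card_mul_sum_sq.trans
      (mul_le_mul_of_nonneg_right hJc (Finset.sum_nonneg fun _ _ => by positivity)))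
  have h4 : ((∑ y ∈ J, ‖W y‖ ^ 2 : ℝ) : ℂ) = ∑ x' ∈ I, ∑ x ∈ I,
      (starRingEnd ℂ (v x) * v x') * shellCorrelation d N (t x) (t x') (x - x') := by
    rw [Complex.ofReal_sum]
    have : ∀ y ∈ J, ((‖W y‖ ^ 2 : ℝ) : ℂ) = ∑ x' ∈ I, ∑ x ∈ I,
        (starRingEnd ℂ (v x) * v x') * (K x y * starRingEnd ℂ (K x' y)) := by
      intro y _
      rw [norm_sq_eq_sum_pairs, Finset.sum_product_right]
      refine Finset.sum_congr rfl fun x' _ => Finset.sum_congr rfl fun x _ => ?_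
      rw [map_mul, Complex.conj_conj]
      ring
    rw [Finset.sum_congr rfl this, Finset.sum_comm]
    refine Finset.sum_congr rfl fun x' _ => ?_
    rw [Finset.sum_comm]
    refine Finset.sum_congr rfl fun x hx => ?_
    rw [← Finset.mul_sum, sum_kernel_mul_conj_kernel hx]
  have h5 : ∀ x' ∈ I, ∑ x ∈ I, ‖shellCorrelation d N (t x) (t x') (x - x')‖ ≤
      κ + 5 * (N : ℝ)⁻¹ := by
    intro x' hx'
    rw [← Finset.sum_erase_add _ _ hx']
    refine add_le_add ?_ (norm_shellCorrelation_le hN _ _ _)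
    -- The bound lets `ν` depend freely on `h`, so `t x` may vary arbitrarily with `x`.
    refine le_trans ?_ (ht x' fun h => t (x' + h))
    rw [← Finset.sum_image (s := I.erase x') (g := fun x => x - x')
      (f := fun h => ‖shellCorrelation d N (t (x' + h)) (t x') h‖)
      (fun _ _ _ _ h => sub_left_injective h) |>.trans
        (Finset.sum_congr rfl fun x _ => by rw [add_sub_cancel])]
    refine Finset.sum_le_sum_of_subset_of_nonneg ?_ fun _ _ _ => norm_nonneg _
    intro h hh
    simp only [hI, Finset.mem_image, Finset.mem_erase, Finset.mem_Ico, Finset.mem_Icc] at hh hx' ⊢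
    omega
  have h6 : ∑ y ∈ J, ‖W y‖ ^ 2 ≤ 25 * (N * (κ + 5 * (N : ℝ)⁻¹)) := by
    have h0 : 0 ≤ ∑ y ∈ J, ‖W y‖ ^ 2 := Finset.sum_nonneg fun _ _ => by positivity
    rw [← abs_of_nonneg h0, ← Real.norm_eq_abs, ← Complex.norm_real, h4]
    have : ((I.card : ℕ) : ℝ) = N := by simp [hI]
    calc _ ≤ ∑ x' ∈ I, 25 * (κ + 5 * (N : ℝ)⁻¹) := by
          refine norm_sum_le_of_le _ fun x' hx' => (norm_sum_le _ _).trans ?_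
          refine le_trans ?_ (mul_le_mul_of_nonneg_left (h5 x' hx') (by norm_num))
          rw [Finset.mul_sum]
          refine Finset.sum_le_sum fun x _ => ?_
          rw [norm_mul, norm_mul, RCLike.norm_conj]
          refine mul_le_mul_of_nonneg_right ?_ (norm_nonneg _)
          calc ‖v x‖ * ‖v x'‖ ≤ 5 * 5 :=
                mul_le_mul (hv x) (hv x') (norm_nonneg _) (by norm_num)
            _ = 25 := by norm_num
      _ = _ := by
          rw [Finset.sum_const, nsmul_eq_mul, this]
          ring
  calc A ^ 2 ≤ 6 * N * ∑ y ∈ J, ‖W y‖ ^ 2 := h3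
    _ ≤ 6 * N * (25 * (N * (κ + 5 * (N : ℝ)⁻¹))) := by gcongr
    _ = _ := by ring

theorem sum_norm_sq_shellSum_le_rpow {d N : ℕ} (hN : 1 ≤ N) {C δ : ℝ} (hC : 0 < C)
    (hδ : δ ≤ 1) (t : ℤ → ℝ)
    (ht : ∀ x : ℤ, ∀ ν : ℤ → ℝ, ∑ h ∈ (Finset.Icc (-(N : ℤ)) N).erase 0,
      ‖shellCorrelation d N (ν h) (t x) h‖ ≤ C * (N : ℝ) ^ (-δ))
    (g : ℤ → ℂ) (hg : ∀ y, ‖g y‖ ≤ 1) (a : ℤ) :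
    ∑ x ∈ Finset.Ico a (a + N), ‖shellSum d N (t x) g x‖ ^ 2 ≤
      (150 * (C + 5)) * (N : ℝ) ^ (1 - δ / 2) := by
  have hN1 : (1 : ℝ) ≤ N := by exact_mod_cast hN
  have hN0 : (0 : ℝ) < N := by positivity
  have h1 := sum_norm_sq_shellSum_le hN t ht g hg a
  refine le_of_sq_le_sq (h1.trans ?_) (by positivity)
  have h2 : (N : ℝ)⁻¹ ≤ (N : ℝ) ^ (-δ) := by
    rw [← Real.rpow_neg_one]
    exact Real.rpow_le_rpow_of_exponent_le hN1 (by linarith)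
  have h3 : ((N : ℝ) ^ (1 - δ / 2)) ^ 2 = (N : ℝ) ^ 2 * (N : ℝ) ^ (-δ) := by
    rw [← Real.rpow_natCast, ← Real.rpow_mul hN0.le, ← Real.rpow_natCast, ← Real.rpow_add hN0]
    congr 1
    push_cast
    ring
  rw [mul_pow, h3]
  have h4 : 150 * (C + 5) ≤ (150 * (C + 5)) ^ 2 := by nlinarith
  calc _ ≤ (150 * (N : ℝ) ^ 2) * (C * (N : ℝ) ^ (-δ) + 5 * (N : ℝ) ^ (-δ)) := by gcongr
    _ = (150 * (C + 5)) * ((N : ℝ) ^ 2 * (N : ℝ) ^ (-δ)) := by ring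
    _ ≤ _ := mul_le_mul_of_nonneg_right h4 (by positivity)

/-! ### Local `ℓ^r` bounds by truncation. -/

/-- Either `u ≤ θ`, or `u² / θ²` already exceeds one. This passes from exponent 2 to `r` on either
side of 2. -/
theorem rpow_le_rpow_add_sq_div {u θ r : ℝ} (hu0 : 0 ≤ u) (hu1 : u ≤ 1) (hθ : 0 < θ)
    (hr : 0 ≤ r) : u ^ r ≤ θ ^ r + u ^ 2 / θ ^ 2 := by
  have h0 : 0 ≤ u ^ 2 / θ ^ 2 := by positivity
  have h1 : 0 ≤ θ ^ r := by positivity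
  rcases le_total u θ with h | h
  · have := Real.rpow_le_rpow hu0 h hr
    linarith
  · have h2 : u ^ r ≤ 1 := Real.rpow_le_one hu0 hu1 hr
    have h3 : 1 ≤ u ^ 2 / θ ^ 2 := by
      rw [one_le_div (by positivity)]
      exact pow_le_pow_left₀ hθ.le h 2
    linarith

theorem add_rpow_le_two_rpow_mul {a b r : ℝ} (ha : 0 ≤ a) (hb : 0 ≤ b) (hr : 0 ≤ r) :
    (a + b) ^ r ≤ 2 ^ r * (a ^ r + b ^ r) := by
  have h1 : 0 ≤ a ^ r := by positivity
  have h2 : 0 ≤ b ^ r := by positivity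
  rcases le_total a b with h | h
  · calc (a + b) ^ r ≤ (2 * b) ^ r := Real.rpow_le_rpow (by positivity) (by linarith) hr
      _ = 2 ^ r * b ^ r := Real.mul_rpow (by norm_num) hb
      _ ≤ _ := mul_le_mul_of_nonneg_left (by linarith) (by positivity)
  · calc (a + b) ^ r ≤ (2 * a) ^ r := Real.rpow_le_rpow (by positivity) (by linarith) hr
      _ = 2 ^ r * a ^ r := Real.mul_rpow (by norm_num) ha
      _ ≤ _ := mul_le_mul_of_nonneg_left (by linarith) (by positivity)

theorem shellSum_add (d N : ℕ) (t : ℝ) (f g : ℤ → ℂ) (x : ℤ) :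
    shellSum d N t (fun y => f y + g y) x = shellSum d N t f x + shellSum d N t g x := by
  simp only [shellSum, mul_add, Finset.sum_add_distrib]

theorem shellSum_const_mul (d N : ℕ) (t : ℝ) (z : ℂ) (g : ℤ → ℂ) (x : ℤ) :
    shellSum d N t (fun y => z * g y) x = z * shellSum d N t g x := by
  simp only [shellSum, Finset.mul_sum]
  exact Finset.sum_congr rfl fun m _ => by ring

/-- With threshold `N ^ (-δ/4)`, small values contribute at most `N ^ (1 - δ/4)` because `r ≥ 1`;
large values lose only `N ^ (δ/2)` from the `ℓ²` gain `N ^ (-δ)`. -/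
theorem sum_rpow_shellSum_bounded_le {d N : ℕ} (hN : 1 ≤ N) {r C δ : ℝ} (hr : 1 ≤ r)
    (hC : 0 < C) (hδ : 0 < δ) (t : ℤ → ℝ) (g : ℤ → ℂ) (hg : ∀ y, ‖g y‖ ≤ 1) (a : ℤ)
    (hL2 : ∑ x ∈ Finset.Ico a (a + N), ‖shellSum d N (t x) g x‖ ^ 2 ≤ C * (N : ℝ) ^ (1 - δ)) :
    ∑ x ∈ Finset.Ico a (a + N), ‖shellSum d N (t x) g x‖ ^ r ≤
      5 ^ r * (1 + C) * (N : ℝ) ^ (1 - δ / 4) := by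
  have hN1 : (1 : ℝ) ≤ N := by exact_mod_cast hN
  have hN0 : (0 : ℝ) < N := by positivity
  set θ : ℝ := (N : ℝ) ^ (-(δ / 4)) with hθ
  have hθ0 : 0 < θ := by positivity
  have h1 : ∀ x, ‖shellSum d N (t x) g x‖ ^ r ≤
      5 ^ r * (θ ^ r + ‖shellSum d N (t x) g x‖ ^ 2 / θ ^ 2) := by
    intro x
    have hb := norm_shellSum_le_of_bounded hN (t x) g hg x (d := d)
    set b := ‖shellSum d N (t x) g x‖
    have hb0 : 0 ≤ b := norm_nonneg _
    have h2 := rpow_le_rpow_add_sq_div (u := b / 5) (by positivity) (by linarith) hθ0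
      (zero_le_one.trans hr)
    have h3 : b ^ r = 5 ^ r * (b / 5) ^ r := by
      rw [← Real.mul_rpow (by norm_num) (by positivity), mul_div_cancel₀ b (by norm_num)]
    have h4 : (b / 5) ^ 2 ≤ b ^ 2 := pow_le_pow_left₀ (by positivity) (by linarith) 2
    rw [h3]
    refine mul_le_mul_of_nonneg_left (h2.trans ?_) (by positivity)
    gcongr
  refine (Finset.sum_le_sum fun x _ => h1 x).trans ?_
  rw [← Finset.mul_sum, Finset.sum_add_distrib, ← Finset.sum_div, Finset.sum_const,
    nsmul_eq_mul, mul_assoc]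
  refine mul_le_mul_of_nonneg_left ?_ (by positivity)
  have hI : (((Finset.Ico a (a + N)).card : ℕ) : ℝ) = N := by simp
  have h5 : N * θ ^ r ≤ (N : ℝ) ^ (1 - δ / 4) := by
    have h : N * (N : ℝ) ^ (-(δ / 4) * r) = (N : ℝ) ^ (1 + -(δ / 4) * r) := by
      rw [Real.rpow_add hN0, Real.rpow_one]
    rw [hθ, ← Real.rpow_mul hN0.le, h]
    refine Real.rpow_le_rpow_of_exponent_le hN1 ?_
    nlinarith
  have h6 : C * (N : ℝ) ^ (1 - δ) / θ ^ 2 ≤ C * (N : ℝ) ^ (1 - δ / 4) := by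
    rw [hθ, ← Real.rpow_natCast, ← Real.rpow_mul hN0.le, mul_div_assoc, ← Real.rpow_sub hN0]
    refine mul_le_mul_of_nonneg_left (Real.rpow_le_rpow_of_exponent_le hN1 ?_) hC.le
    push_cast
    linarith
  rw [hI]
  calc _ ≤ (N : ℝ) ^ (1 - δ / 4) + C * (N : ℝ) ^ (1 - δ) / θ ^ 2 := by gcongr
    _ ≤ (N : ℝ) ^ (1 - δ / 4) + C * (N : ℝ) ^ (1 - δ / 4) := by gcongr
    _ = _ := by ring

/-- A local `ℓ^r` bound, from the `ℓ²` bound for bounded functions, by splitting `f` at a height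
slightly above its `r`-th power mean. -/
theorem sum_rpow_shellSum_le {d N : ℕ} (hN : 1 ≤ N) {r C δ : ℝ} (hr : 1 < r)
    (hC : 0 < C) (hδ : 0 < δ) (t : ℤ → ℝ) (a : ℤ)
    (hL2 : ∀ g : ℤ → ℂ, (∀ y, ‖g y‖ ≤ 1) →
      ∑ x ∈ Finset.Ico a (a + N), ‖shellSum d N (t x) g x‖ ^ 2 ≤ C * (N : ℝ) ^ (1 - δ))
    (f : ℤ → ℂ) :
    ∑ x ∈ Finset.Ico a (a + N), ‖shellSum d N (t x) f x‖ ^ r ≤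
      (2 ^ r * (1 + 5 ^ r * (1 + C))) * (N : ℝ) ^ (-(δ / 8 * min 1 (r - 1))) *
        ∑ y ∈ Finset.Icc (a - 2 * N) (a + 3 * N), ‖f y‖ ^ r := by
  have hN1 : (1 : ℝ) ≤ N := by exact_mod_cast hN
  have hN0 : (0 : ℝ) < N := by positivity
  have hr0 : 0 < r := by linarith
  set I := Finset.Ico a (a + N) with hI
  set J := Finset.Icc (a - 2 * N) (a + 3 * N) with hJ
  have hIc : ((I.card : ℕ) : ℝ) = N := by simp [hI]
  set Φ := ∑ y ∈ J, ‖f y‖ ^ r with hΦ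
  have hΦ0 : 0 ≤ Φ := Finset.sum_nonneg fun _ _ => by positivity
  rcases hΦ0.eq_or_lt with h0 | hpos
  · have hf : ∀ y ∈ J, ‖f y‖ = 0 := by
      intro y hy
      have := (Finset.sum_eq_zero_iff_of_nonneg fun _ _ => by positivity).1 h0.symm y hy
      exact (Real.rpow_eq_zero (norm_nonneg _) hr0.ne').1 this
    have h1 : ∀ x ∈ I, ‖shellSum d N (t x) f x‖ ^ r = 0 := by
      intro x hx
      have h2 := norm_shellSum_le (d := d) hN hx (t x) f
      rw [Finset.sum_eq_zero hf, mul_zero] at h2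
      rw [le_antisymm h2 (norm_nonneg _), Real.zero_rpow hr0.ne']
    rw [Finset.sum_eq_zero h1]
    positivity
  · set A : ℝ := (Φ / N) ^ (1 / r) with hA
    have hA0 : 0 < A := by positivity
    have hAr : A ^ r = Φ / N := by
      rw [hA, ← Real.rpow_mul (by positivity), one_div_mul_cancel hr0.ne', Real.rpow_one]
    -- `A` is an `r`-th power mean of `f`, and the cut is at height `K A`. The part above it gains
    -- `K ^ (1 - r)` from the trivial kernel bound; the part below loses `K ^ r = N ^ (δ/8)` against
    -- a gain of `N ^ (-δ/4)`.
    set K : ℝ := (N : ℝ) ^ (δ / (8 * r)) with hK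
    have hK0 : 0 < K := by positivity
    set L := K * A with hL
    have hL0 : 0 < L := by positivity
    let f1 : ℤ → ℂ := fun y => if ‖f y‖ ≤ L then 0 else f y
    let g : ℤ → ℂ := fun y => if ‖f y‖ ≤ L then (L : ℂ)⁻¹ * f y else 0
    have hsplit : f = fun y => f1 y + (L : ℂ) * g y := by
      funext y
      simp only [f1, g]
      split_ifs
      · have : (L : ℂ) ≠ 0 := by exact_mod_cast hL0.ne'
        rw [zero_add, mul_inv_cancel_left₀ this]
      · ring
    have hg : ∀ y, ‖g y‖ ≤ 1 := by
      intro y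
      simp only [g]
      split_ifs with h
      · rw [norm_mul, norm_inv, Complex.norm_real, Real.norm_eq_abs, abs_of_pos hL0,
          inv_mul_le_iff₀ hL0, mul_one]
        exact h
      · simp
    have hf1 : ∀ y, ‖f1 y‖ ≤ L ^ (1 - r) * ‖f y‖ ^ r := by
      intro y
      simp only [f1]
      split_ifs with h
      · rw [norm_zero]
        positivity
      · have hy : 0 < ‖f y‖ := hL0.trans (not_le.1 h)
        have h1 : ‖f y‖ ^ (1 - r) ≤ L ^ (1 - r) :=
          Real.rpow_le_rpow_of_nonpos hL0 (not_le.1 h).le (by linarith)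
        calc ‖f y‖ = ‖f y‖ ^ (1 - r) * ‖f y‖ ^ r := by
              rw [← Real.rpow_add hy, sub_add_cancel, Real.rpow_one]
          _ ≤ _ := mul_le_mul_of_nonneg_right h1 (by positivity)
    have hT1 : ∀ x ∈ I, ‖shellSum d N (t x) f1 x‖ ≤ K ^ (1 - r) * A := by
      intro x hx
      refine (norm_shellSum_le hN hx _ _).trans ?_
      calc (N : ℝ)⁻¹ * ∑ y ∈ J, ‖f1 y‖ ≤ (N : ℝ)⁻¹ * (L ^ (1 - r) * Φ) := by
            refine mul_le_mul_of_nonneg_left ?_ (by positivity)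
            rw [hΦ, Finset.mul_sum]
            exact Finset.sum_le_sum fun y _ => hf1 y
        _ = L ^ (1 - r) * A ^ r := by
            rw [hAr]
            ring
        _ = K ^ (1 - r) * (A ^ (1 - r) * A ^ r) := by
            rw [hL, Real.mul_rpow hK0.le hA0.le]
            ring
        _ = _ := by rw [← Real.rpow_add hA0, sub_add_cancel, Real.rpow_one]
    have hS1 : ∑ x ∈ I, ‖shellSum d N (t x) f1 x‖ ^ r ≤
        (N : ℝ) ^ (-(δ / 8 * min 1 (r - 1))) * Φ := by
      calc _ ≤ ∑ x ∈ I, (K ^ (1 - r) * A) ^ r := Finset.sum_le_sum fun x hx =>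
            Real.rpow_le_rpow (norm_nonneg _) (hT1 x hx) hr0.le
        _ = (K ^ (1 - r)) ^ r * Φ := by
            rw [Finset.sum_const, nsmul_eq_mul, hIc, Real.mul_rpow (by positivity) hA0.le, hAr]
            field_simp
        _ ≤ _ := by
            refine mul_le_mul_of_nonneg_right ?_ hΦ0
            rw [hK, ← Real.rpow_mul hN0.le, ← Real.rpow_mul hN0.le]
            refine Real.rpow_le_rpow_of_exponent_le hN1 ?_
            have h1 : δ / (8 * r) * (1 - r) * r = -(δ / 8 * (r - 1)) := by
              field_simp
              ring
            rw [h1]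
            have := min_le_right 1 (r - 1)
            have h8 : 0 < δ / 8 := by positivity
            nlinarith
    have hS2 : ∑ x ∈ I, ‖(L : ℂ) * shellSum d N (t x) g x‖ ^ r ≤
        5 ^ r * (1 + C) * ((N : ℝ) ^ (-(δ / 8 * min 1 (r - 1))) * Φ) := by
      have h1 := sum_rpow_shellSum_bounded_le hN hr.le hC hδ t g hg a (hL2 g hg)
      have h2 : ∀ x, ‖(L : ℂ) * shellSum d N (t x) g x‖ ^ r =
          L ^ r * ‖shellSum d N (t x) g x‖ ^ r := by
        intro x
        rw [norm_mul, Complex.norm_real, Real.norm_eq_abs, abs_of_pos hL0,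
          Real.mul_rpow hL0.le (norm_nonneg _)]
      simp_rw [h2]
      rw [← Finset.mul_sum]
      calc _ ≤ L ^ r * (5 ^ r * (1 + C) * (N : ℝ) ^ (1 - δ / 4)) := by gcongr
        _ = 5 ^ r * (1 + C) * ((K ^ r * ((N : ℝ) ^ (1 - δ / 4) / N)) * Φ) := by
            rw [hL, Real.mul_rpow hK0.le hA0.le, hAr]
            ring
        _ ≤ _ := by
            refine mul_le_mul_of_nonneg_left (mul_le_mul_of_nonneg_right ?_ hΦ0) (by positivity)
            have h3 : (N : ℝ) ^ (1 - δ / 4) / N = (N : ℝ) ^ (-(δ / 4)) := by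
              rw [div_eq_iff hN0.ne', ← Real.rpow_add_one hN0.ne']
              congr 1
              ring
            rw [h3, hK, ← Real.rpow_mul hN0.le, ← Real.rpow_add hN0]
            refine Real.rpow_le_rpow_of_exponent_le hN1 ?_
            have h4 : δ / (8 * r) * r = δ / 8 := by field_simp
            rw [h4]
            have := min_le_left 1 (r - 1)
            have h8 : 0 < δ / 8 := by positivity
            nlinarith
    calc _ ≤ ∑ x ∈ I, 2 ^ r * (‖shellSum d N (t x) f1 x‖ ^ r +
          ‖(L : ℂ) * shellSum d N (t x) g x‖ ^ r) := by
          refine Finset.sum_le_sum fun x _ => ?_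
          rw [hsplit, shellSum_add, shellSum_const_mul]
          exact (Real.rpow_le_rpow (norm_nonneg _) (norm_add_le _ _) hr0.le).trans
            (add_rpow_le_two_rpow_mul (norm_nonneg _) (norm_nonneg _) hr0.le)
      _ ≤ 2 ^ r * ((N : ℝ) ^ (-(δ / 8 * min 1 (r - 1))) * Φ +
          5 ^ r * (1 + C) * ((N : ℝ) ^ (-(δ / 8 * min 1 (r - 1))) * Φ)) := by
          rw [← Finset.mul_sum, Finset.sum_add_distrib]
          gcongr
      _ = _ := by ring

/-! ### From local to global norms. -/

theorem tsum_sum_translate (g : ℤ → ℝ≥0∞) (s : Finset ℤ) :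
    ∑' a : ℤ, ∑ x ∈ s, g (a + x) = s.card * ∑' x, g x := by
  rw [Summable.tsum_finsetSum fun _ _ => ENNReal.summable]
  have : ∀ x ∈ s, ∑' a : ℤ, g (a + x) = ∑' a, g a := fun x _ => (Equiv.addRight x).tsum_eq g
  rw [Finset.sum_congr rfl this, Finset.sum_const, nsmul_eq_mul]

theorem sum_Ico_translate (g : ℤ → ℝ≥0∞) (a n : ℤ) :
    ∑ x ∈ Finset.Ico a (a + n), g x = ∑ x ∈ Finset.Ico 0 n, g (a + x) := by
  rw [← Finset.sum_image (s := Finset.Ico 0 n) (g := fun x => a + x)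
    fun _ _ _ _ h => add_left_cancel h, Finset.image_add_left_Ico, add_zero]

theorem sum_Icc_translate (g : ℤ → ℝ≥0∞) (a m n : ℤ) :
    ∑ x ∈ Finset.Icc (a + m) (a + n), g x = ∑ x ∈ Finset.Icc m n, g (a + x) := by
  rw [← Finset.sum_image (s := Finset.Icc m n) (g := fun x => a + x)
    fun _ _ _ _ h => add_left_cancel h, Finset.image_add_left_Icc]

/-- Globalisation of local estimates at scale `N`. -/
theorem tsum_le_of_local {N : ℕ} (hN : 1 ≤ N) (u v : ℤ → ℝ≥0∞) (B : ℝ≥0∞)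
    (h : ∀ a : ℤ, ∑ x ∈ Finset.Ico a (a + N), u x ≤
      B * ∑ y ∈ Finset.Icc (a - 2 * N) (a + 3 * N), v y) :
    ∑' x, u x ≤ 6 * B * ∑' x, v x := by
  -- Summing over all `a` counts each `x` exactly `N` times and each `y` exactly `5N + 1 ≤ 6N`
  -- times.
  have h1 : ∑' a : ℤ, ∑ x ∈ Finset.Ico (0 : ℤ) N, u (a + x) ≤
      ∑' a : ℤ, B * ∑ y ∈ Finset.Icc (-(2 * N : ℤ)) (3 * N), v (a + y) := by
    refine ENNReal.tsum_le_tsum fun a => ?_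
    rw [← sum_Ico_translate, ← sum_Icc_translate, ← sub_eq_add_neg]
    exact h a
  rw [ENNReal.tsum_mul_left, tsum_sum_translate, tsum_sum_translate, Int.card_Ico,
    Int.card_Icc] at h1
  have e1 : ((N : ℤ) - 0).toNat = N := by omega
  have e2 : ((3 * N : ℤ) + 1 - -(2 * N : ℤ)).toNat ≤ N * 6 := by omega
  have e3 : ((((3 * N : ℤ) + 1 - -(2 * N : ℤ)).toNat : ℕ) : ℝ≥0∞) ≤ N * 6 := by
    exact_mod_cast e2
  rw [e1] at h1
  have hN0 : (N : ℝ≥0∞) ≠ 0 := by exact_mod_cast (by omega : N ≠ 0)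
  rw [← ENNReal.mul_le_mul_iff_right hN0 (ENNReal.natCast_ne_top N)]
  calc _ ≤ _ := h1
    _ ≤ B * ((N * 6) * ∑' x, v x) := by gcongr
    _ = _ := by ring

theorem ofReal_sum_norm_rpow (s : Finset ℤ) (u : ℤ → ℂ) {r : ℝ} (hr : 0 ≤ r) :
    ENNReal.ofReal (∑ x ∈ s, ‖u x‖ ^ r) = ∑ x ∈ s, ‖u x‖ₑ ^ r := by
  rw [ENNReal.ofReal_sum_of_nonneg fun _ _ => by positivity]
  refine Finset.sum_congr rfl fun x _ => ?_
  rw [← ENNReal.ofReal_rpow_of_nonneg (norm_nonneg _) hr, ofReal_norm]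

theorem eLpNorm_le_of_local {N : ℕ} (hN : 1 ≤ N) {p : ℝ≥0∞} (hp : 1 < p) (hp' : p < ∞)
    (u f : ℤ → ℂ) {B : ℝ} (hB : 0 ≤ B)
    (h : ∀ a : ℤ, ∑ x ∈ Finset.Ico a (a + N), ‖u x‖ ^ p.toReal ≤
      B * ∑ y ∈ Finset.Icc (a - 2 * N) (a + 3 * N), ‖f y‖ ^ p.toReal) :
    eLpNorm u p Measure.count ≤
      ENNReal.ofReal ((6 * B) ^ (1 / p.toReal)) * eLpNorm f p Measure.count := by
  have hp0 : p ≠ 0 := (zero_lt_one.trans hp).ne'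
  have hr : 0 < p.toReal := ENNReal.toReal_pos hp0 hp'.ne
  have h1 := tsum_le_of_local hN (fun x => ‖u x‖ₑ ^ p.toReal) (fun x => ‖f x‖ₑ ^ p.toReal)
    (ENNReal.ofReal B) (fun a => by
      rw [← ofReal_sum_norm_rpow _ _ hr.le, ← ofReal_sum_norm_rpow _ _ hr.le,
        ← ENNReal.ofReal_mul hB]
      exact ENNReal.ofReal_le_ofReal (h a))
  rw [eLpNorm_eq_lintegral_rpow_enorm_toReal hp0 hp'.ne,
    eLpNorm_eq_lintegral_rpow_enorm_toReal hp0 hp'.ne, lintegral_count, lintegral_count,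
    ← ENNReal.ofReal_rpow_of_nonneg (by positivity) (by positivity),
    ← ENNReal.mul_rpow_of_nonneg _ _ (by positivity)]
  refine ENNReal.rpow_le_rpow (h1.trans (le_of_eq ?_)) (by positivity)
  rw [ENNReal.ofReal_mul (by norm_num)]
  simp

/-- Shell sums at scale `N` with modulation parameters off an exceptional set of measure
`O(N^(-1/4))` have `ℓ^p` operator norm `O(N^(-η))`. -/
theorem exists_exceptional_set_eLpNorm {d : ℕ} (hd : 2 ≤ d) {p : ℝ≥0∞} (hp : 1 < p)
    (hp' : p < ∞) : ∃ C η : ℝ, 0 < C ∧ 0 < η ∧ ∀ N : ℕ, 1 ≤ N → ∃ S : Set ℝ,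
      MeasurableSet S ∧ S ⊆ Set.Icc 0 1 ∧
      volume S ≤ ENNReal.ofReal (C * (N : ℝ) ^ (-(1 / 4) : ℝ)) ∧
      ∀ t : ℤ → ℝ, (∀ x, t x ∈ Set.Icc (0 : ℝ) 1 \ S) → ∀ f : ℤ → ℂ,
        eLpNorm (fun x => shellSum d N (t x) f x) p Measure.count ≤
          ENNReal.ofReal (C * (N : ℝ) ^ (-η)) * eLpNorm f p Measure.count := by
  obtain ⟨C, δ, hC, hδ, hδ1, hset⟩ := exists_exceptional_set hd
  have hr : 1 < p.toReal := by
    rw [← ENNReal.toReal_one]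
    exact (ENNReal.toReal_lt_toReal ENNReal.one_ne_top hp'.ne).2 hp
  set r := p.toReal
  set C' : ℝ := 2 ^ r * (1 + 5 ^ r * (1 + 150 * (C + 5))) with hC'
  have hC'0 : 0 < C' := by positivity
  have hmin : 0 < min 1 (r - 1) := lt_min one_pos (by linarith)
  refine ⟨max C ((6 * C') ^ (1 / r)), δ / 2 / 8 * min 1 (r - 1) * (1 / r),
    lt_max_of_lt_left hC, by positivity, fun N hN => ?_⟩
  have hN0 : (0 : ℝ) < N := by exact_mod_cast hN
  obtain ⟨S, hS1, hS2, hS3, hS4⟩ := hset N hN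
  refine ⟨S, hS1, hS2, hS3.trans (ENNReal.ofReal_le_ofReal
    (mul_le_mul_of_nonneg_right (le_max_left _ _) (by positivity))), fun t ht f => ?_⟩
  have h1 := eLpNorm_le_of_local hN hp hp' (fun x => shellSum d N (t x) f x) f
    (B := C' * (N : ℝ) ^ (-(δ / 2 / 8 * min 1 (r - 1)))) (by positivity)
    (fun a => sum_rpow_shellSum_le hN hr (by positivity) (by positivity) t a
      (fun g hg => sum_norm_sq_shellSum_le_rpow hN hC hδ1 t
        (fun x ν => hS4 (t x) (ht x) ν) g hg a) f)
  refine h1.trans (mul_le_mul_left (ENNReal.ofReal_le_ofReal ?_) _)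
  rw [← mul_assoc, Real.mul_rpow (by positivity) (by positivity), ← Real.rpow_mul hN0.le, neg_mul]
  exact mul_le_mul_of_nonneg_right (le_max_right _ _) (by positivity)

/-! ### Absolute convergence and the dyadic decomposition. -/

/-- The summand of the modulated Hilbert transform, as a function on all integers; it vanishes
at `m = 0`. -/
noncomputable def hilbertTerm (d : ℕ) (f : ℤ → ℂ) (t : ℝ) (x m : ℤ) : ℂ :=
  (m : ℂ)⁻¹ * addExp (t * (m : ℝ) ^ d) * f (x - m)

theorem modulatedTerm_eq (d : ℕ) (f : ℤ → ℂ) (t : ℝ) (x : ℤ) :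
    modulatedTerm d f t x = hilbertTerm d f t x ∘ Subtype.val := by
  funext m
  have : (2 * Real.pi * Complex.I * (t : ℂ) * (m.1 : ℂ) ^ d) =
      2 * Real.pi * Complex.I * ((t * (m.1 : ℝ) ^ d : ℝ) : ℂ) := by
    push_cast
    ring
  rw [modulatedTerm, this, Function.comp_apply, hilbertTerm, addExp]
  ring

theorem hilbertTerm_eq_zero {d : ℕ} {f : ℤ → ℂ} {t : ℝ} {x m : ℤ}
    (hm : m ∉ Set.range (Subtype.val : {m : ℤ // m ≠ 0} → ℤ)) : hilbertTerm d f t x m = 0 := by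
  have : m = 0 := by
    by_contra h
    exact hm ⟨⟨m, h⟩, rfl⟩
  simp [hilbertTerm, this]

theorem modulatedHilbert_eq (d : ℕ) (f : ℤ → ℂ) (t : ℝ) (x : ℤ) :
    modulatedHilbert d f t x = ∑' m, hilbertTerm d f t x m := by
  rw [modulatedHilbert, modulatedTerm_eq]
  refine Subtype.val_injective.tsum_eq (f := hilbertTerm d f t x) fun m hm => ?_
  by_contra h
  exact hm (hilbertTerm_eq_zero h)

theorem norm_hilbertTerm (d : ℕ) (f : ℤ → ℂ) (t : ℝ) (x m : ℤ) :
    ‖hilbertTerm d f t x m‖ = ‖f (x - m)‖ * |(m : ℝ)|⁻¹ := by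
  rw [hilbertTerm, norm_mul, norm_mul, norm_addExp, mul_one, norm_inv, Complex.norm_intCast,
    mul_comm]

theorem one_lt_toReal {p : ℝ≥0∞} (hp : 1 < p) (hp' : p < ∞) : 1 < p.toReal := by
  rw [← ENNReal.toReal_one]
  exact (ENNReal.toReal_lt_toReal ENNReal.one_ne_top hp'.ne).2 hp

theorem summable_norm_mul_inv_abs {p : ℝ≥0∞} (hp : 1 < p) (hp' : p < ∞) {f : ℤ → ℂ}
    (hf : MemLp f p Measure.count) (x : ℤ) : Summable fun m : ℤ => ‖f (x - m)‖ * |(m : ℝ)|⁻¹ := by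
  have hr := one_lt_toReal hp hp'
  have hpq := Real.HolderConjugate.conjExponent hr
  have h1 : Summable fun m : ℤ => ‖f m‖ ^ p.toReal := by
    have := hf.integrable_norm_rpow (zero_lt_one.trans hp).ne' hp'.ne
    rw [integrable_count_iff] at this
    exact this.congr fun m => by rw [Real.norm_eq_abs, abs_of_nonneg (by positivity)]
  have h2 : Summable fun m : ℤ => ‖f (x - m)‖ ^ p.toReal :=
    h1.comp_injective (i := fun m => x - m) sub_right_injective
  have h3 : Summable fun m : ℤ => (|(m : ℝ)|⁻¹) ^ p.toReal.conjExponent := by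
    have := Real.summable_abs_int_rpow hpq.symm.lt
    refine this.congr fun m => ?_
    rw [Real.rpow_neg (abs_nonneg _), Real.inv_rpow (abs_nonneg _)]
  exact Real.summable_mul_of_Lp_Lq_of_nonneg hpq (fun _ => norm_nonneg _)
    (fun _ => by positivity) h2 h3

theorem summable_hilbertTerm {p : ℝ≥0∞} (hp : 1 < p) (hp' : p < ∞) {f : ℤ → ℂ}
    (hf : MemLp f p Measure.count) (d : ℕ) (t : ℝ) (x : ℤ) : Summable (hilbertTerm d f t x) := by
  refine Summable.of_norm ?_
  simp_rw [norm_hilbertTerm]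
  exact summable_norm_mul_inv_abs hp hp' hf x

theorem sum_shellSum_eq (d : ℕ) (f : ℤ → ℂ) (t : ℝ) (x : ℤ) (n : ℕ) :
    ∑ j ∈ Finset.range n, shellSum d (2 ^ j) t f x =
      ∑ m ∈ Finset.Ioo (-(2 : ℤ) ^ n) (2 ^ n), hilbertTerm d f t x m := by
  induction n with
  | zero =>
    -- Only `m = 0` is left, and its term vanishes because `0⁻¹ = 0`.
    have : Finset.Ioo (-(2 : ℤ) ^ 0) (2 ^ 0) = {0} := by decide
    rw [this]
    simp [hilbertTerm]
  | succ n ih =>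
    rw [Finset.sum_range_succ, ih]
    have hpos : (0 : ℤ) < 2 ^ n := by positivity
    set M : ℤ := 2 ^ n with hM
    have hM2 : (2 : ℤ) ^ (n + 1) = 2 * M := by rw [hM, pow_succ, mul_comm]
    have h1 : shellSum d (2 ^ n) t f x =
        ∑ m ∈ (Finset.Icc (-(2 * M)) (2 * M)).filter (fun m => M ≤ |m| ∧ |m| < 2 * M),
          hilbertTerm d f t x m := by
      rw [shellSum, Finset.sum_filter]
      push_cast
      refine Finset.sum_congr rfl fun m _ => ?_
      rw [shellKernel]
      push_cast
      split_ifs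
      · rfl
      · ring
    rw [hM2, h1, ← Finset.sum_union]
    · refine Finset.sum_congr ?_ fun _ _ => rfl
      ext m
      simp only [Finset.mem_union, Finset.mem_Ioo, Finset.mem_filter, Finset.mem_Icc, le_abs, abs_lt]
      omega
    · rw [Finset.disjoint_left]
      intro m h2 h3
      simp only [Finset.mem_Ioo, Finset.mem_filter, le_abs] at h2 h3
      omega

theorem tendsto_sum_shellSum {p : ℝ≥0∞} (hp : 1 < p) (hp' : p < ∞) {f : ℤ → ℂ}
    (hf : MemLp f p Measure.count) (d : ℕ) (t : ℝ) (x : ℤ) :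
    Filter.Tendsto (fun n => ∑ j ∈ Finset.range n, shellSum d (2 ^ j) t f x) Filter.atTop
      (nhds (modulatedHilbert d f t x)) := by
  have h1 : Filter.Tendsto (fun n : ℕ => Finset.Ioo (-(2 : ℤ) ^ n) (2 ^ n))
      Filter.atTop Filter.atTop := by
    refine Filter.tendsto_atTop_finset_of_monotone (fun m n hmn => ?_) fun x => ?_
    · have : (2 : ℤ) ^ m ≤ 2 ^ n := pow_le_pow_right₀ (by norm_num) hmn
      exact Finset.Ioo_subset_Ioo (by omega) this
    · refine ⟨x.natAbs, ?_⟩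
      have : (x.natAbs : ℤ) < 2 ^ x.natAbs := by exact_mod_cast Nat.lt_two_pow_self
      rw [Finset.mem_Ioo]
      omega
  rw [modulatedHilbert_eq]
  simp_rw [sum_shellSum_eq]
  exact (summable_hilbertTerm hp hp' hf d t x).hasSum.comp h1

/-- The kernel is at most `1/N` on a window of at most `6N` points, so Hölder suffices and no
condition on `t` is needed. This serves the coarse count of small scales. -/
theorem eLpNorm_shellSum_le {d N : ℕ} (hN : 1 ≤ N) {p : ℝ≥0∞} (hp : 1 < p) (hp' : p < ∞)
    (t : ℤ → ℝ) (f : ℤ → ℂ) :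
    eLpNorm (fun x => shellSum d N (t x) f x) p Measure.count ≤
      ENNReal.ofReal 6 * eLpNorm f p Measure.count := by
  have hr := one_lt_toReal hp hp'
  have h1 := eLpNorm_le_of_local hN hp hp' (fun x => shellSum d N (t x) f x) f
    (B := 6 ^ (p.toReal - 1)) (by positivity)
  set r := p.toReal
  have hr0 : 0 < r := by linarith
  have hN0 : (0 : ℝ) < N := by exact_mod_cast hN
  have h6 : (6 * (6 : ℝ) ^ (r - 1)) ^ (1 / r) = 6 := by
    have : 6 * (6 : ℝ) ^ (r - 1) = 6 ^ r := by
      rw [← Real.rpow_one_add' (by norm_num) (by linarith)]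
      congr 1
      ring
    rw [this, ← Real.rpow_mul (by norm_num), mul_one_div_cancel hr0.ne', Real.rpow_one]
  rw [h6] at h1
  refine h1 fun a => ?_
  set J := Finset.Icc (a - 2 * N) (a + 3 * N) with hJ
  have hJc : (J.card : ℝ) ≤ 6 * N := by
    rw [hJ, Int.card_Icc]
    have : (a + 3 * N + 1 - (a - 2 * N)).toNat ≤ 6 * N := by omega
    exact_mod_cast this
  have h2 : (∑ y ∈ J, ‖f y‖) ^ r ≤ (6 * N) ^ (r - 1) * ∑ y ∈ J, ‖f y‖ ^ r :=
    (Real.rpow_sum_le_const_mul_sum_rpow_of_nonneg J hr.le fun _ _ => norm_nonneg _).trans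
      (mul_le_mul_of_nonneg_right
        (Real.rpow_le_rpow (by positivity) hJc (by linarith)) (by positivity))
  calc ∑ x ∈ Finset.Ico a (a + N), ‖shellSum d N (t x) f x‖ ^ r
      ≤ ∑ x ∈ Finset.Ico a (a + N), ((N : ℝ)⁻¹ * ∑ y ∈ J, ‖f y‖) ^ r :=
        Finset.sum_le_sum fun x hx =>
          Real.rpow_le_rpow (norm_nonneg _) (norm_shellSum_le hN hx _ _) hr0.le
    _ = N * (((N : ℝ) ^ r)⁻¹ * (∑ y ∈ J, ‖f y‖) ^ r) := by
        rw [Finset.sum_const, nsmul_eq_mul, Real.mul_rpow (by positivity) (by positivity),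
          Real.inv_rpow hN0.le]
        simp
    _ ≤ N * (((N : ℝ) ^ r)⁻¹ * ((6 * N) ^ (r - 1) * ∑ y ∈ J, ‖f y‖ ^ r)) := by gcongr
    _ = _ := by
        rw [Real.mul_rpow (by norm_num) hN0.le, Real.rpow_sub_one hN0.ne']
        field_simp

/-! ### Linearising the supremum and summing the scales. -/

theorem restrictedCarleson_lt_top {p : ℝ≥0∞} (hp : 1 < p) (hp' : p < ∞) {f : ℤ → ℂ}
    (hf : MemLp f p Measure.count) (d : ℕ) (E : Set ℝ) (x : ℤ) :
    restrictedCarleson d E f x < ∞ := by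
  refine lt_of_le_of_lt (b := ENNReal.ofReal (∑' m : ℤ, ‖f (x - m)‖ * |(m : ℝ)|⁻¹)) ?_
    ENNReal.ofReal_lt_top
  refine iSup₂_le fun t _ => ?_
  rw [← ofReal_norm, modulatedHilbert_eq]
  refine ENNReal.ofReal_le_ofReal ?_
  have h := summable_norm_mul_inv_abs hp hp' hf x
  refine tsum_of_norm_bounded h.hasSum fun m => (norm_hilbertTerm d f t x m).le

/-- A finite nonzero supremum exceeds its half, so some parameter attains at least half of it; this
is the source of the factor 2. -/
theorem exists_linearization {p : ℝ≥0∞} (hp : 1 < p) (hp' : p < ∞) {f : ℤ → ℂ}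
    (hf : MemLp f p Measure.count) (d : ℕ) {E : Set ℝ} (hE : (Set.Icc 0 1 \ E).Nonempty) :
    ∃ t : ℤ → ℝ, (∀ x, t x ∈ Set.Icc 0 1 \ E) ∧
      ∀ x, restrictedCarleson d E f x ≤ 2 * ‖modulatedHilbert d f (t x) x‖ₑ := by
  have key : ∀ x, ∃ t ∈ Set.Icc 0 1 \ E,
      restrictedCarleson d E f x ≤ 2 * ‖modulatedHilbert d f t x‖ₑ := by
    intro x
    by_cases h0 : restrictedCarleson d E f x = 0
    · obtain ⟨t, ht⟩ := hE
      exact ⟨t, ht, by simp [h0]⟩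
    · have h1 := ENNReal.half_lt_self h0 (restrictedCarleson_lt_top hp hp' hf d E x).ne
      nth_rewrite 2 [restrictedCarleson] at h1
      simp only [lt_iSup_iff] at h1
      obtain ⟨t, ht, h2⟩ := h1
      refine ⟨t, ht, ?_⟩
      rw [mul_comm]
      exact (ENNReal.div_le_iff (by norm_num) (by norm_num)).1 h2.le
  choose t h1 h2 using key
  exact ⟨t, h1, h2⟩

theorem eLpNorm_restrictedCarleson_le {d : ℕ} {p : ℝ≥0∞} (hp : 1 < p) (hp' : p < ∞) {E : Set ℝ}
    {f : ℤ → ℂ} (hf : MemLp f p Measure.count) (b : ℕ → ℝ) (hb : ∀ j, 0 ≤ b j) (B : ℝ)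
    (hB : ∀ n, ∑ j ∈ Finset.range n, b j ≤ B)
    (h : ∀ j, ∀ t : ℤ → ℝ, (∀ x, t x ∈ Set.Icc 0 1 \ E) →
      eLpNorm (fun x => shellSum d (2 ^ j) (t x) f x) p Measure.count ≤
        ENNReal.ofReal (b j) * eLpNorm f p Measure.count) :
    eLpNorm (restrictedCarleson d E f) p Measure.count ≤
      ENNReal.ofReal (2 * B) * eLpNorm f p Measure.count := by
  -- If `E` is all of `[0, 1]` the supremum is over nothing and equals zero.
  rcases (Set.Icc 0 1 \ E).eq_empty_or_nonempty with hE | hE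
  · have : restrictedCarleson d E f = 0 := by
      funext x
      simp [restrictedCarleson, hE]
    rw [this, eLpNorm_zero]
    exact zero_le
  · obtain ⟨t, ht, hlin⟩ := exists_linearization hp hp' hf d hE
    have h1 : eLpNorm (fun x => modulatedHilbert d f (t x) x) p Measure.count ≤
        ENNReal.ofReal B * eLpNorm f p Measure.count := by
      -- Fatou's lemma reduces the full series to partial sums over shells, and Minkowski adds their
      -- norms.
      refine (Lp.eLpNorm_lim_le_liminf_eLpNorm
        (f := fun n x => ∑ j ∈ Finset.range n, shellSum d (2 ^ j) (t x) f x)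
        (fun n => AEStronglyMeasurable.of_discrete) _
        (Filter.Eventually.of_forall fun x => tendsto_sum_shellSum hp hp' hf d (t x) x)).trans ?_
      refine Filter.liminf_le_of_frequently_le' (Filter.Frequently.of_forall fun n => ?_)
      have h2 := eLpNorm_sum_le (p := p) (μ := (Measure.count : Measure ℤ))
        (f := fun j x => shellSum d (2 ^ j) (t x) f x) (s := Finset.range n)
        (fun j _ => AEStronglyMeasurable.of_discrete) hp.le
      have h3 : (∑ j ∈ Finset.range n, fun x => shellSum d (2 ^ j) (t x) f x) =
          fun x => ∑ j ∈ Finset.range n, shellSum d (2 ^ j) (t x) f x := by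
        funext x
        rw [Finset.sum_apply]
      rw [h3] at h2
      refine h2.trans ((Finset.sum_le_sum fun j _ => h j t ht).trans ?_)
      rw [← Finset.sum_mul, ← ENNReal.ofReal_sum_of_nonneg fun j _ => hb j]
      exact mul_le_mul_left (ENNReal.ofReal_le_ofReal (hB n)) _
    have h2 : eLpNorm (restrictedCarleson d E f) p Measure.count ≤
        eLpNorm ((2 : ℂ) • fun x => modulatedHilbert d f (t x) x) p Measure.count := by
      refine eLpNorm_mono_enorm fun x => ?_
      rw [enorm_eq_self, Pi.smul_apply, smul_eq_mul, enorm_mul]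
      refine (hlin x).trans (le_of_eq ?_)
      congr 1
      rw [← ofReal_norm]
      simp
    refine h2.trans ?_
    rw [eLpNorm_const_smul, ENNReal.ofReal_mul (by norm_num), mul_assoc]
    refine mul_le_mul' (le_of_eq ?_) h1
    rw [← ofReal_norm]
    simp

/-! ### Choice of the cut-off scale and conclusion. -/

theorem exists_nat_mul_pow_lt {M ρ : ℝ} (hM : 0 < M) (hρ0 : 0 < ρ) (hρ1 : ρ < 1) :
    ∃ A : ℝ, 0 < A ∧ ∀ ε : ℝ, 0 < ε → ∃ J : ℕ, M * ρ ^ J < ε ∧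
      (J : ℝ) ≤ A * max 1 (Real.log (1 / ε)) := by
  set κ := -Real.log ρ with hκ
  have hκ0 : 0 < κ := neg_pos.2 (Real.log_neg hρ0 hρ1)
  refine ⟨(|Real.log M| + 1) / κ + 1, by positivity, fun ε hε => ?_⟩
  set L := max 1 (Real.log (1 / ε)) with hL
  have hL1 : 1 ≤ L := le_max_left _ _
  have hL2 : Real.log (1 / ε) ≤ L := le_max_right _ _
  refine ⟨⌊(|Real.log M| + L) / κ⌋₊ + 1, ?_, ?_⟩
  · set J := ⌊(|Real.log M| + L) / κ⌋₊ + 1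
    have h1 : (|Real.log M| + L) / κ < (J : ℝ) := by
      have := Nat.lt_floor_add_one ((|Real.log M| + L) / κ)
      push_cast [J]
      exact this
    rw [div_lt_iff₀ hκ0] at h1
    rw [← Real.log_lt_log_iff (by positivity) hε, Real.log_mul hM.ne' (by positivity),
      Real.log_pow]
    have h2 := le_abs_self (Real.log M)
    rw [one_div, Real.log_inv] at hL2
    have h3 : (J : ℝ) * Real.log ρ = -(J * κ) := by rw [hκ]; ring
    linarith
  · have h1 : (⌊(|Real.log M| + L) / κ⌋₊ : ℝ) ≤ (|Real.log M| + L) / κ :=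
      Nat.floor_le (by positivity)
    push_cast
    have h2 : (|Real.log M| + L) / κ ≤ (|Real.log M| + 1) * L / κ := by
      gcongr
      nlinarith [abs_nonneg (Real.log M)]
    calc _ ≤ (|Real.log M| + 1) * L / κ + L := by linarith
      _ = _ := by ring

theorem two_pow_rpow_neg (j : ℕ) (η : ℝ) :
    (((2 ^ j : ℕ) : ℝ)) ^ (-η) = ((2 : ℝ) ^ (-η)) ^ j := by
  push_cast
  rw [← Real.rpow_natCast, ← Real.rpow_natCast, ← Real.rpow_mul (by norm_num),
    ← Real.rpow_mul (by norm_num), mul_comm]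

theorem two_rpow_neg_lt_one {η : ℝ} (hη : 0 < η) : (2 : ℝ) ^ (-η) < 1 :=
  Real.rpow_lt_one_of_one_lt_of_neg (by norm_num) (by linarith)

theorem sum_range_geometric_le {ρ : ℝ} (hρ0 : 0 ≤ ρ) (hρ1 : ρ < 1) (n : ℕ) :
    ∑ j ∈ Finset.range n, ρ ^ j ≤ (1 - ρ)⁻¹ := by
  rw [← tsum_geometric_of_lt_one hρ0 hρ1]
  exact (summable_geometric_of_lt_one hρ0 hρ1).sum_le_tsum _ fun _ _ => by positivity

theorem measure_iUnion_le_geometric {S : ℕ → Set ℝ} {C ρ : ℝ} (hC : 0 ≤ C) (hρ0 : 0 ≤ ρ)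
    (hρ1 : ρ < 1) (J : ℕ) (hS : ∀ j, volume (S j) ≤ ENNReal.ofReal (C * ρ ^ j)) :
    volume (⋃ i, S (J + i)) ≤ ENNReal.ofReal (C * (1 - ρ)⁻¹ * ρ ^ J) := by
  refine (measure_iUnion_le _).trans ((ENNReal.tsum_le_tsum fun i => hS (J + i)).trans ?_)
  have hs : Summable fun i => C * ρ ^ (J + i) := by
    simp_rw [pow_add]
    exact ((summable_geometric_of_lt_one hρ0 hρ1).mul_left _).mul_left _
  rw [← ENNReal.ofReal_tsum_of_nonneg (fun i => by positivity) hs]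
  refine ENNReal.ofReal_le_ofReal (le_of_eq ?_)
  simp_rw [pow_add]
  rw [tsum_mul_left, tsum_mul_left, tsum_geometric_of_lt_one hρ0 hρ1]
  ring

theorem mainTheorem9 (d : ℕ) (hd : 2 ≤ d) (p : ℝ≥0∞) (hp : 1 < p) (hp' : p < ∞) :
    ∃ C : ℝ, 0 < C ∧ ∀ ε : ℝ, 0 < ε →
      ∃ E : Set ℝ, E ⊆ Set.Icc 0 1 ∧ MeasurableSet E ∧ volume E < ENNReal.ofReal ε ∧
        ∀ f : ℤ → ℂ, MemLp f p Measure.count →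
          (∀ (t : ℝ) (x : ℤ), Summable (modulatedTerm d f t x)) ∧
          eLpNorm (restrictedCarleson d E f) p Measure.count ≤
            ENNReal.ofReal (C * max 1 (Real.log (1 / ε))) * eLpNorm f p Measure.count := by
  obtain ⟨C, η, hC, hη, hset⟩ := exists_exceptional_set_eLpNorm hd hp hp'
  choose S hS1 hS2 hS3 hS4 using fun j : ℕ => hset (2 ^ j) Nat.one_le_two_pow
  set ρ : ℝ := 2 ^ (-(1 / 4) : ℝ) with hρ
  set σ : ℝ := 2 ^ (-η) with hσ
  have hρ0 : 0 < ρ := by positivity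
  have hσ0 : 0 < σ := by positivity
  have hρ1 : ρ < 1 := two_rpow_neg_lt_one (by norm_num)
  have hσ1 : σ < 1 := two_rpow_neg_lt_one hη
  have hρ1' : 0 < 1 - ρ := by linarith
  have hσ1' : 0 < 1 - σ := by linarith
  obtain ⟨A, hA, hJ⟩ := exists_nat_mul_pow_lt (M := C * (1 - ρ)⁻¹) (by positivity) hρ0 hρ1
  -- Linearisation gives the 2, the `J ≤ A * L` small scales give `6 A`, and the geometric sum over
  -- the others gives the rest, absorbed because `L ≥ 1`.
  refine ⟨2 * (6 * A + C * (1 - σ)⁻¹), by positivity, fun ε hε => ?_⟩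
  obtain ⟨J, hJ1, hJ2⟩ := hJ ε hε
  set L := max 1 (Real.log (1 / ε)) with hL
  have hL1 : 1 ≤ L := le_max_left _ _
  refine ⟨⋃ i, S (J + i), Set.iUnion_subset fun i => hS2 _, MeasurableSet.iUnion fun i => hS1 _,
    ?_, fun f hf => ⟨fun t x => ?_, ?_⟩⟩
  · refine (measure_iUnion_le_geometric hC.le hρ0.le hρ1 J fun j => ?_).trans_lt
      ((ENNReal.ofReal_lt_ofReal_iff hε).2 hJ1)
    rw [hρ, ← two_pow_rpow_neg]
    exact hS3 j
  · rw [modulatedTerm_eq]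
    exact (summable_hilbertTerm hp hp' hf d t x).comp_injective Subtype.val_injective
  · have key := eLpNorm_restrictedCarleson_le (d := d) (E := ⋃ i, S (J + i)) hp hp' hf
      (fun j => (if j < J then 6 else 0) + C * σ ^ j)
      (fun j => by split_ifs <;> positivity) (6 * J + C * (1 - σ)⁻¹)
      (fun n => by
        rw [Finset.sum_add_distrib, ← Finset.mul_sum, ← Finset.sum_filter, Finset.sum_const,
          nsmul_eq_mul]
        have h1 : ((Finset.range n).filter fun j => j < J).card ≤ J := by
          refine (Finset.card_le_card fun j hj => ?_).trans (Finset.card_range J).le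
          exact Finset.mem_range.2 (Finset.mem_filter.1 hj).2
        have h2 : (((Finset.range n).filter fun j => j < J).card : ℝ) ≤ J := by exact_mod_cast h1
        have h3 := mul_le_mul_of_nonneg_left (sum_range_geometric_le hσ0.le hσ1 n) hC.le
        linarith)
      (fun j t ht => by
        by_cases hj : j < J
        · refine (eLpNorm_shellSum_le Nat.one_le_two_pow hp hp' t f).trans
            (mul_le_mul_left (ENNReal.ofReal_le_ofReal ?_) _)
          rw [if_pos hj]
          have : 0 ≤ C * σ ^ j := by positivity
          linarith
        · rw [if_neg hj, zero_add, hσ, ← two_pow_rpow_neg]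
          refine hS4 j t (fun x => ⟨(ht x).1, fun hx => (ht x).2 (Set.mem_iUnion.2 ⟨j - J, ?_⟩)⟩) f
          rwa [Nat.add_sub_cancel' (not_lt.1 hj)])
    refine key.trans (mul_le_mul_left (ENNReal.ofReal_le_ofReal ?_) _)
    have h4 : 0 < C * (1 - σ)⁻¹ := by positivity
    nlinarith
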